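/- Let $\mathcal M$ be a continuous-time Markov decision process with finite sets $L$ of locations and $Act$ of actions, rates $R(l,a,l')\ge 0$, an absorbing goal region $G\subseteq L$ (that is, $R(l,a,l')=0$ for $l\in G$, $l'\notin G$), and an initial distribution $\nu$ on $L$, such that for every location $l$ the set $Act(l)$ of enabled actions (those $a$ with $R(l,a,L)=\sum_{l'}R(l,a,l')>0$) is nonempty. Let $t_{\max}\ge 0$. A timed history-dependent randomised (THR) scheduler maps a timed path $\pi=l_0\xrightarrow{a_0,t_0}l_1\cdots\xrightarrow{a_{n-1},t_{n-1}}l_n$ (with $0\le t_0\le\cdots\le t_{n-1}\le t_{\max}$) and a time $t$ to a probability distribution on $Act(l_n)$; under it, in history $\pi$ at time $t$, a transition to $l'$ with action $a$ is taken at rate $\mathcal S(\pi,t)(a)\,R(l_n,a,l')$. It is cylindrical if, for some partition of $[0,t_{\max}]$ into finitely many intervals $[0,t_0],(t_0,t_1],\dots$, it depends only on the locations and actions of $\pi$ and on the intervals containing the times of $\pi$ and $t$. For a cylindrical scheduler, $Pr_{\mathcal S}(l,t)$ is the probability of visiting $G$ up to time $t_{\max}$ when starting in $l$ at time $t$ (with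 the one-location history $l$). The distance of two cylindrical schedulers $D,E$ is the probability that, starting from $\nu$ at time $0$, the following difference process reaches a fresh absorbing location $g$ up to time $t_{\max}$: on every history it chooses each action $a$ with the minimum of the probabilities $p_D(a)$, $p_E(a)$ given to it by $D$ and $E$; with the remaining probability it chooses a fresh action that leads only to $g$, with rate $R(l,a_D,L)+R(l,a_E,L)$, where $a_D$ has maximal exit rate $R(l,\cdot,L)$ among the actions with $p_D>p_E$, and $a_E$ among those with $p_E>p_D$. A measurable THR scheduler $\mathcal S$ is (represented by) a Cauchy sequence $(\mathcal S_n)$ of cylindrical THR schedulers for this distance, and $Pr_{\mathcal S}(l,t)=\lim_n Pr_{\mathcal S_n}(l,t)$, $Pr_{\mathcal S}(t_{\max})=\lim_n\sum_l\nu(l)Pr_{\mathcal S_n}(l,0)$. For $\mathsf{opt}\in\{\max,\min\}$ let $f_{\mathsf{opt}}:L\times[0,t_{\max}]\to\mathbb R$ solve $$-\dot f_{\mathsf{opt}}(l,t)=\mathop{\mathsf{opt}}_{a\in Act(l)}\sum_{l'\in L}R(l,a,l')\bigl(f_{\mathsf{opt}}(l',t)-f_{\mathsf{opt}}(l,t)\bigr)\qquad(l\in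 L,\ t\in[0,t_{\max}])$$ (with one-sided derivatives at the end points), with $f_{\mathsf{opt}}(l,t)=1$ for $l\in G$, $t\in[0,t_{\max}]$, and $f_{\mathsf{opt}}(l,t_{\max})=0$ for $l\notin G$. Then for every measurable THR scheduler $\mathcal S$, every $l\in L$ and every $t\in[0,t_{\max}]$, $$f_{\min}(l,t)\le Pr_{\mathcal S}(l,t)\le f_{\max}(l,t)$$ whenever the limit $Pr_{\mathcal S}(l,t)$ exists, and it does exist whenever $\nu(l)>0$. Moreover $Pr_{\mathcal S}(t_{\max})$ exists and $$\sum_{l}\nu(l)f_{\min}(l,0)\le Pr_{\mathcal S}(t_{\max})\le\sum_{l}\nu(l)f_{\max}(l,0).$$ -/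

import Mathlib

open MeasureTheory Filter Topology
open scoped NNReal ENNReal

/-- A (traditional, late-scheduling) continuous-time Markov decision process over finitely many
locations `L` and actions `Act`: only continuous locations, one player. The jump probabilities
`P(l,a,l') = R(l,a,l') / R(l,a,L)` are determined by the rates. -/
structure CTMDP (L Act : Type*) [Fintype L] [Fintype Act] where
  /-- the rate matrix `R(l,a,l')` -/
  rate : L → Act → L → ℝ≥0
  /-- the goal region `G` -/
  goal : Set L
  /-- the initial distribution `ν` -/
  init : L → ℝ≥0
  init_sum : ∑ l, init l = 1
  /-- every location has an enabled action, i.e. an action with positive exit rate -/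
  exists_enabled : ∀ l, ∃ a, 0 < ∑ l', rate l a l'
  /-- the goal region is absorbing -/
  absorbing : ∀ l ∈ goal, ∀ a, ∀ l' ∉ goal, rate l a l' = 0

/-- Timed paths `l₀ --(a₀,t₀)--> l₁ --(a₁,t₁)--> ⋯ lₙ`, where `tᵢ` is the system time at which
the transition from `lᵢ` to `lᵢ₊₁` is taken. -/
inductive TimedPath (L Act : Type*) where
  | start (l : L) : TimedPath L Act
  | step (π : TimedPath L Act) (a : Act) (t : ℝ) (l : L) : TimedPath L Act

namespace TimedPath

variable {L Act : Type*}

/-- The last location of a path. -/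
def last : TimedPath L Act → L
  | start l => l
  | step _ _ _ l => l

/-- The time of the last transition (`0` if there is none). -/
def clock : TimedPath L Act → ℝ
  | start _ => 0
  | step _ _ t _ => t

/-- The times are ordered, and they lie in `[0, T]`. -/
def IsTimed (T : ℝ) : TimedPath L Act → Prop
  | start _ => True
  | step π _ t _ => π.IsTimed T ∧ π.clock ≤ t ∧ t ≤ T

/-- The path contains a location from `G`. -/
def Visits (G : Set L) : TimedPath L Act → Prop
  | start l => l ∈ G
  | step π _ _ l => π.Visits G ∨ l ∈ G

end TimedPath

/-- For a finite set `J = {t₀ < ⋯ < tₙ = T}` of endpoints, the times `s, t ∈ [0, T]` lie in the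
same interval of the partition `[0,t₀], (t₀,t₁], …, (tₙ₋₁,tₙ]`. -/
def SameCell (J : Finset ℝ) (s t : ℝ) : Prop :=
  ∀ c ∈ J, (s ≤ c ↔ t ≤ c)

/-- Two timed paths have the same cylindrification with respect to the partition given by `J`. -/
def TimedPath.SameCylinder {L Act : Type*} (J : Finset ℝ) :
    TimedPath L Act → TimedPath L Act → Prop
  | .start l, .start l' => l = l'
  | .step π a t l, .step π' a' t' l' =>
      TimedPath.SameCylinder J π π' ∧ a = a' ∧ SameCell J t t' ∧ l = l'
  | _, _ => False

namespace CTMDP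

variable {L Act : Type*} [Fintype L] [Fintype Act]

/-- The exit rate `R(l,a,L)`. -/
def exitRate (M : CTMDP L Act) (l : L) (a : Act) : ℝ≥0 := ∑ l', M.rate l a l'

open Classical in
/-- The set `Act(l)` of enabled actions. -/
noncomputable def enabled (M : CTMDP L Act) (l : L) : Finset Act :=
  Finset.univ.filter fun a => 0 < M.exitRate l a

theorem mem_enabled {M : CTMDP L Act} {l : L} {a : Act} :
    a ∈ M.enabled l ↔ 0 < M.exitRate l a := by
  rw [enabled, Finset.mem_filter]
  exact and_iff_right (Finset.mem_univ a)

theorem enabled_nonempty (M : CTMDP L Act) (l : L) : (M.enabled l).Nonempty := by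
  obtain ⟨a, ha⟩ := M.exists_enabled l
  exact ⟨a, mem_enabled.2 ha⟩

/-! ### The differential equations for `f_max` and `f_min` -/

/-- `∑_{l'} R(l,a,l') (v(l') - v(l))`. -/
def drift (M : CTMDP L Act) (v : L → ℝ) (l : L) (a : Act) : ℝ :=
  ∑ l', (M.rate l a l' : ℝ) * (v l' - v l)

/-- `f(l,t) = 1` for goal locations and `t ≤ T`, `f(l,T) = 0` for the other locations. -/
def BoundaryConditions (M : CTMDP L Act) (T : ℝ) (f : L → ℝ → ℝ) : Prop :=
  (∀ l ∈ M.goal, ∀ t ∈ Set.Icc 0 T, f l t = 1) ∧ ∀ l ∉ M.goal, f l T = 0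

/-- `f = f_max`: on `[0, T]` (with one-sided derivatives at the end points)
`-f'(l,t) = max_{a ∈ Act(l)} ∑_{l'} R(l,a,l') (f(l',t) - f(l,t))`. -/
def IsFMax (M : CTMDP L Act) (T : ℝ) (f : L → ℝ → ℝ) : Prop :=
  M.BoundaryConditions T f ∧ ∀ l, ∀ t ∈ Set.Icc 0 T,
    HasDerivWithinAt (f l)
      (-(M.enabled l).sup' (M.enabled_nonempty l) (M.drift (fun l' => f l' t) l))
      (Set.Icc 0 T) t

/-- `f = f_min`: on `[0, T]` (with one-sided derivatives at the end points)
`-f'(l,t) = min_{a ∈ Act(l)} ∑_{l'} R(l,a,l') (f(l',t) - f(l,t))`. -/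
def IsFMin (M : CTMDP L Act) (T : ℝ) (f : L → ℝ → ℝ) : Prop :=
  M.BoundaryConditions T f ∧ ∀ l, ∀ t ∈ Set.Icc 0 T,
    HasDerivWithinAt (f l)
      (-(M.enabled l).inf' (M.enabled_nonempty l) (M.drift (fun l' => f l' t) l))
      (Set.Icc 0 T) t

/-! ### Schedulers and the law of the complete timed path -/

/-- A timed history-dependent randomised (THR) scheduler: it maps a timed path and the current
time to a distribution over the actions enabled in the last location of the path.
(Values at paths that are not ordered in time, or at negative times, are never used.) -/
structure Scheduler (M : CTMDP L Act) where
  prob : TimedPath L Act → ℝ → Act → ℝ≥0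
  sum_eq_one : ∀ π t, ∑ a, prob π t a = 1
  enabled_of_ne_zero : ∀ π t a, prob π t a ≠ 0 → a ∈ M.enabled π.last

namespace Scheduler

variable {M : CTMDP L Act}

/-- The scheduler is cylindrical: for some partition of `[0, T]` into finitely many intervals its
decisions depend only on the cylindrification of the path and of the time. -/
def IsCylindrical (S : M.Scheduler) (T : ℝ) : Prop :=
  ∃ J : Finset ℝ, (∀ c ∈ J, c ∈ Set.Icc 0 T) ∧ T ∈ J ∧
    ∀ π π' : TimedPath L Act, ∀ t ∈ Set.Icc 0 T, ∀ t' ∈ Set.Icc 0 T,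
      π.IsTimed T → π'.IsTimed T → TimedPath.SameCylinder J π π' → SameCell J t t' →
        S.prob π t = S.prob π' t'

/-- The expected exit rate `∑ₐ pₐ R(l,a,L)` at time `t` after the history `π` ending in `l`. -/
def exitRate (S : M.Scheduler) (π : TimedPath L Act) (t : ℝ) : ℝ≥0 :=
  ∑ a, S.prob π t a * M.exitRate π.last a

/-- The probability of not taking any transition in `(t, s]` after the history `π`. -/
noncomputable def survival (S : M.Scheduler) (π : TimedPath L Act) (t s : ℝ) : ℝ≥0∞ :=
  ENNReal.ofReal (Real.exp (-∫ u in t..s, (S.exitRate π u : ℝ)))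

/-- The law of the complete timed path. `S.pathProb T A n π t` is the probability that, if the
system is at time `t` with history `π`, then exactly `n` further transitions are taken
up to time `T` and the resulting complete path belongs to `A`. The `n` transitions are integrated
out one after the other: while the history is `π`, the transition with action `a` to `l'` is
taken at time `s` with rate `S(π,s)(a) * R(l,a,l')`. -/
noncomputable def pathProb (S : M.Scheduler) (T : ℝ) (A : Set (TimedPath L Act)) :
    ℕ → TimedPath L Act → ℝ → ℝ≥0∞
  | 0, π, t => A.indicator (fun _ => 1) π * S.survival π t T
  | n + 1, π, t => ∫⁻ s in Set.Ioc t T, S.survival π t s *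
      ∑ a, ∑ l', ((S.prob π s a * M.rate π.last a l' : ℝ≥0) : ℝ≥0∞) *
        S.pathProb T A n (π.step a s l') s

/-- `Pr_S(π,t)`: the probability that the complete path visits the goal region (up to time `T`),
if the system is at time `t` with history `π`; it is the limit over `n` of the probability to do
so on a path with at most `n` further transitions. -/
noncomputable def reachProbFrom (S : M.Scheduler) (T : ℝ) (π : TimedPath L Act) (t : ℝ) : ℝ :=
  (∑' n, S.pathProb T {ρ | ρ.Visits M.goal} n π t).toReal

/-- `Pr_S(l,t)`: the probability of reaching the goal region up to time `T`, when starting in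
location `l` at time `t`. -/
noncomputable def reachProb (S : M.Scheduler) (T : ℝ) (l : L) (t : ℝ) : ℝ :=
  S.reachProbFrom T (.start l) t

/-- `∑ₗ ν(l) Pr_S(l,0)`: the time-bounded reachability probability for the time bound `T`. -/
noncomputable def totalReachProb (S : M.Scheduler) (T : ℝ) : ℝ :=
  ∑ l, (M.init l : ℝ) * S.reachProb T l 0

end Scheduler

/-! ### The distance of two schedulers -/

/-- The actions of the difference process: the old actions `a`, the fresh actions `(a,b)`, and a
fresh action (`none`) that is the only enabled action of the fresh goal location. -/
abbrev DiffAct (Act : Type*) := Option (Act ⊕ Act × Act)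

/-- The rates of the difference process; `none : Option L` is the fresh goal location, entered by
the fresh action `(a,b)` with rate `R(l,a,L) + R(l,b,L)`. -/
def diffRate (M : CTMDP L Act) : Option L → DiffAct Act → Option L → ℝ≥0
  | some l, some (.inl a), some l' => M.rate l a l'
  | some l, some (.inr (a, b)), none => M.exitRate l a + M.exitRate l b
  | none, none, none => 1
  | _, _, _ => 0

/-- The difference process: its only goal location is the fresh one. -/
def diff (M : CTMDP L Act) : CTMDP (Option L) (DiffAct Act) where
  rate := M.diffRate
  goal := {none}
  init := fun x => x.elim 0 M.init
  init_sum := by simp [Fintype.sum_option, M.init_sum]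
  exists_enabled := by
    rintro (_ | l)
    · exact ⟨none, by simp [Fintype.sum_option, diffRate]⟩
    · obtain ⟨a, ha⟩ := M.exists_enabled l
      exact ⟨some (.inl a), by simpa [Fintype.sum_option, diffRate] using ha⟩
  absorbing := by
    rintro l rfl a (_ | l') h
    · simp at h
    · rcases a with _ | a | a <;> rfl

/-- The path of the original process underlying a path of the difference process that uses only
old locations and old actions. -/
def oldPath : TimedPath (Option L) (DiffAct Act) → Option (TimedPath L Act)
  | .start (some l) => some (.start l)
  | .step π (some (.inl a)) t (some l) => (oldPath π).map fun ρ => ρ.step a t l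
  | _ => none

open Classical in
/-- Among the actions with `p a > q a`, one with maximal exit rate from `l` (if there is any).
Ties can be broken arbitrarily, since only the exit rate of the chosen action matters. -/
noncomputable def surplusAction (M : CTMDP L Act) (l : L) (p q : Act → ℝ≥0) : Option Act :=
  if h : (Finset.univ.filter fun a => q a < p a).Nonempty then
    some (Finset.exists_max_image _ (M.exitRate l) h).choose
  else none

open Classical in
/-- The decision of the difference scheduler in `l`, if the two schedulers choose the
distributions `p` and `q`: an old action `a` with probability `min (p a) (q a)`, and with the
remaining probability a fresh action `(a,b)`, where `a` is a surplus action of `p` and `b` one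
of `q`. -/
noncomputable def diffDecision (M : CTMDP L Act) (l : L) (p q : Act → ℝ≥0) : DiffAct Act → ℝ≥0
  | none => 0
  | some (.inl a) => min (p a) (q a)
  | some (.inr (a, b)) =>
      if M.surplusAction l p q = some a ∧ M.surplusAction l q p = some b then
        1 - ∑ c, min (p c) (q c)
      else 0

theorem surplusAction_spec {M : CTMDP L Act} {l : L} {p q : Act → ℝ≥0} {a : Act}
    (h : M.surplusAction l p q = some a) : q a < p a := by
  classical
  unfold surplusAction at h
  split_ifs at h with hn
  have := (Finset.exists_max_image _ (M.exitRate l) hn).choose_spec.1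
  rw [Option.some.inj h] at this
  simpa using this

theorem eq_of_surplusAction_eq_none {M : CTMDP L Act} {l : L} {p q : Act → ℝ≥0}
    (hp : ∑ a, p a = 1) (hq : ∑ a, q a = 1) (h : M.surplusAction l p q = none) : p = q := by
  classical
  unfold surplusAction at h
  split_ifs at h with hn
  have hle : ∀ a ∈ Finset.univ, p a ≤ q a := by
    intro a _
    by_contra hlt
    exact hn ⟨a, by simpa using hlt⟩
  funext a
  exact (Finset.sum_eq_sum_iff_of_le hle).1 (hp.trans hq.symm) a (Finset.mem_univ a)

theorem sum_diffDecision {M : CTMDP L Act} {l : L} {p q : Act → ℝ≥0}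
    (hp : ∑ a, p a = 1) (hq : ∑ a, q a = 1) : ∑ x, M.diffDecision l p q x = 1 := by
  classical
  have hmin : ∑ c, min (p c) (q c) ≤ 1 := hp ▸ Finset.sum_le_sum fun c _ => min_le_left _ _
  simp only [Fintype.sum_option, Fintype.sum_sum_type, Fintype.sum_prod_type, diffDecision,
    zero_add]
  rcases h₁ : M.surplusAction l p q with _ | a
  · simp [eq_of_surplusAction_eq_none hp hq h₁, hq]
  rcases h₂ : M.surplusAction l q p with _ | b
  · simp [eq_of_surplusAction_eq_none hq hp h₂, hp]
  simp only [Option.some.injEq]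
  have key : ∀ r : ℝ≥0, ∑ x, ∑ y, (if a = x ∧ b = y then r else 0) = r := by
    intro r
    rw [Finset.sum_eq_single a, Finset.sum_eq_single b]
    · simp
    · intro y _ hy
      simp [hy.symm]
    · simp
    · intro x _ hx
      simp [hx.symm]
    · simp
  rw [key, add_tsub_cancel_of_le hmin]

theorem last_of_oldPath {L Act : Type*} {π : TimedPath (Option L) (DiffAct Act)} {ρ : TimedPath L Act}
    (h : oldPath π = some ρ) : π.last = some ρ.last := by
  rcases π with (_ | l) | ⟨π, (_ | a | a), t, (_ | l)⟩ <;> simp [oldPath] at h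
  · subst h; rfl
  · obtain ⟨σ, _, rfl⟩ := h; rfl

theorem enabled_of_diffDecision_ne_zero {M : CTMDP L Act} {l : L} {p q : Act → ℝ≥0}
    (hp : ∀ a, p a ≠ 0 → a ∈ M.enabled l) {x : DiffAct Act} (hx : M.diffDecision l p q x ≠ 0) :
    x ∈ M.diff.enabled (some l) := by
  classical
  rcases x with _ | a | ⟨a, b⟩
  · simp [diffDecision] at hx
  · have ha : p a ≠ 0 := fun h => hx (by simp [diffDecision, h])
    have := mem_enabled.1 (hp a ha)
    rw [mem_enabled]
    simpa [exitRate, diff, diffRate, Fintype.sum_option] using this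
  · have hs : M.surplusAction l p q = some a := by
      by_contra h
      exact hx (by simp [diffDecision, h])
    have ha : 0 < M.exitRate l a := mem_enabled.1 (hp a (pos_of_gt (surplusAction_spec hs)).ne')
    have hab : 0 < M.exitRate l a + M.exitRate l b := lt_of_lt_of_le ha le_self_add
    rw [mem_enabled]
    change 0 < ∑ l', M.diffRate (some l) (some (.inr (a, b))) l'
    rw [Fintype.sum_option]
    exact lt_of_lt_of_le hab le_self_add

open Classical in
/-- The difference scheduler of two schedulers: on histories that use only old actions it decides
as above, in the fresh goal location it chooses the only enabled action. (The remaining histories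
cannot occur; some enabled action is chosen there.) -/
noncomputable def Scheduler.diff {M : CTMDP L Act} (D E : M.Scheduler) : M.diff.Scheduler where
  prob π t x :=
    match oldPath π with
    | some ρ => M.diffDecision ρ.last (D.prob ρ t) (E.prob ρ t) x
    | none => if x = (M.diff.exists_enabled π.last).choose then 1 else 0
  sum_eq_one π t := by
    rcases h : oldPath π with _ | ρ
    · simp
    · simpa using sum_diffDecision (D.sum_eq_one ρ t) (E.sum_eq_one ρ t)
  enabled_of_ne_zero π t x hx := by
    rcases h : oldPath π with _ | ρ
    · simp only [h] at hx
      have hx' : x = (M.diff.exists_enabled π.last).choose := by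
        by_contra hne
        exact hx (if_neg hne)
      rw [hx', mem_enabled]
      exact (M.diff.exists_enabled π.last).choose_spec
    · simp only [h] at hx
      rw [last_of_oldPath h]
      exact enabled_of_diffDecision_ne_zero (D.enabled_of_ne_zero ρ t) hx

/-- The distance of two schedulers: the probability that the difference scheduler reaches the
fresh goal location within the time bound `T`, i.e. that the two act observably different. -/
noncomputable def Scheduler.distance {M : CTMDP L Act} (T : ℝ) (D E : M.Scheduler) : ℝ :=
  (D.diff E).totalReachProb T

/-- A measurable THR scheduler for the time bound `T`, represented by a Cauchy sequence of
cylindrical THR schedulers. -/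
structure MeasurableScheduler (M : CTMDP L Act) (T : ℝ) where
  seq : ℕ → M.Scheduler
  cylindrical : ∀ n, (seq n).IsCylindrical T
  cauchy : ∀ ε > 0, ∃ N, ∀ m > N, ∀ n > N, Scheduler.distance T (seq m) (seq n) < ε

namespace MeasurableScheduler

variable {M : CTMDP L Act} {T : ℝ}

/-- `Pr_S(l,t) = p`: the reachability probability of a Cauchy sequence is the limit of those of its
elements. -/
def HasReachProb (S : M.MeasurableScheduler T) (l : L) (t p : ℝ) : Prop :=
  Tendsto (fun n => (S.seq n).reachProb T l t) atTop (𝓝 p)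

/-- `∑ₗ ν(l) Pr_S(l,0) = p`, again as a limit along the Cauchy sequence. -/
def HasTotalReachProb (S : M.MeasurableScheduler T) (p : ℝ) : Prop :=
  Tendsto (fun n => (S.seq n).totalReachProb T) atTop (𝓝 p)

end MeasurableScheduler

end CTMDP

/-!
The probability `w π t` that a cylindrical scheduler `S` visits the goal region from the history `π`
at time `t` solves the backward equation `-w' = S.generator w` off the finitely many end points of
the partition. The generator satisfies a comparison principle: for a subsolution `w` that is
nonpositive at `T`, uniformization and induction on `n` give `w ≤ B (C (T - t)) ^ n / n!`, hence
`w ≤ 0`. Extended to histories by the value `1` after a visit to the goal region, `f_max` is a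
supersolution and `f_min` a subsolution with the terminal values of `w`, whatever the scheduler.

The gap between the reachability probabilities of two schedulers, as a function of the histories of
their difference process, is a subsolution of the backward equation of that process: the rate of the
fresh action is at least that of every transition that only one scheduler takes. So the distance
bounds the gap, and the reachability probabilities along a Cauchy sequence of schedulers converge.
For one location `l` and a start time `t > 0` this uses that the probability of hitting the fresh
goal from `l` at time `t` is at most `exp (C t)` times the one at time `0`, since staying in `l`
until time `t` has probability at least `exp (-C t)`.
-/

/-! ### Monotonicity off a finite set -/

theorem le_of_hasDerivAt_nonneg_off_finset (J : Finset ℝ) {g : ℝ → ℝ} {a b : ℝ} (hab : a ≤ b)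
    (hcont : ContinuousOn g (Set.Icc a b))
    (hderiv : ∀ t ∈ Set.Ioo a b \ J, ∃ g', HasDerivAt g g' t ∧ 0 ≤ g') : g a ≤ g b := by
  induction J using Finset.induction_on generalizing a b with
  | empty =>
    simp only [Finset.coe_empty, Set.sdiff_empty] at hderiv
    choose! g' hg' hnonneg using hderiv
    refine monotoneOn_of_hasDerivWithinAt_nonneg (convex_Icc a b) hcont (f' := g')
      (fun t ht => ?_) (fun t ht => ?_) (Set.left_mem_Icc.2 hab) (Set.right_mem_Icc.2 hab) hab
    all_goals rw [interior_Icc] at ht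
    · exact (hg' t ht).hasDerivWithinAt
    · exact hnonneg t ht
  | insert c J _ ih =>
    have split {x y : ℝ} (hxy : x ≤ y) (hax : a ≤ x) (hyb : y ≤ b) (hc : c ∉ Set.Ioo x y) :
        g x ≤ g y := by
      refine ih hxy (hcont.mono (Set.Icc_subset_Icc hax hyb)) fun t ht => hderiv t
        ⟨Set.Ioo_subset_Ioo hax hyb ht.1, ?_⟩
      rw [Finset.coe_insert, Set.mem_insert_iff, not_or]
      exact ⟨fun h => hc (h ▸ ht.1), ht.2⟩
    by_cases hc : c ∈ Set.Ioo a b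
    · exact (split hc.1.le le_rfl hc.2.le fun h => h.2.false).trans
        (split hc.2.le hc.1.le le_rfl fun h => h.1.false)
    · exact split hab le_rfl le_rfl hc

theorem hasDerivAt_exp_neg_mul {d : ℝ → ℝ} {d' t : ℝ} (C : ℝ) (hd : HasDerivAt d d' t) :
    HasDerivAt (fun s => Real.exp (-C * s) * d s) (Real.exp (-C * t) * (d' - C * d t)) t := by
  refine ((((hasDerivAt_id t).const_mul (-C)).exp).mul hd).congr_deriv ?_
  simp only [id]
  ring

/-! ### The terms of the exponential series -/

/-- The `n`-th term of the series of `exp (C * (T - t))`. It bounds the probability of `n`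
transitions in `(t, T]` when all exit rates are at most `C`. -/
noncomputable def expTerm (C T : ℝ) (n : ℕ) (t : ℝ) : ℝ := (C * (T - t)) ^ n / n.factorial

theorem expTerm_zero (C T t : ℝ) : expTerm C T 0 t = 1 := by simp [expTerm]

theorem expTerm_nonneg {C T t : ℝ} (hC : 0 ≤ C) (ht : t ≤ T) (n : ℕ) : 0 ≤ expTerm C T n t :=
  div_nonneg (pow_nonneg (mul_nonneg hC (sub_nonneg.2 ht)) n) (Nat.cast_nonneg _)

theorem expTerm_antitone {C T t s : ℝ} (hC : 0 ≤ C) (hts : t ≤ s) (hsT : s ≤ T) (n : ℕ) :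
    expTerm C T n s ≤ expTerm C T n t :=
  div_le_div_of_nonneg_right (pow_le_pow_left₀ (mul_nonneg hC (sub_nonneg.2 hsT))
    (mul_le_mul_of_nonneg_left (sub_le_sub_left hts T) hC) n) (Nat.cast_nonneg _)

theorem hasDerivAt_expTerm_succ (C T : ℝ) (n : ℕ) (t : ℝ) :
    HasDerivAt (expTerm C T (n + 1)) (-(C * expTerm C T n t)) t := by
  have hlin : HasDerivAt (fun s => C * (T - s)) (-C) t := by
    simpa using ((hasDerivAt_id t).const_sub T).const_mul C
  refine ((hlin.pow (n + 1)).div_const ((n + 1).factorial : ℝ)).congr_deriv ?_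
  rw [expTerm, Nat.factorial_succ]
  push_cast
  field_simp

theorem continuous_expTerm (C T : ℝ) (n : ℕ) : Continuous (expTerm C T n) := by
  unfold expTerm
  fun_prop

theorem integral_expTerm (C T : ℝ) (n : ℕ) (t : ℝ) :
    ∫ s in t..T, C * expTerm C T n s = expTerm C T (n + 1) t := by
  have h := intervalIntegral.integral_eq_sub_of_hasDerivAt (a := t) (b := T)
    (fun s _ => (hasDerivAt_expTerm_succ C T n s).neg)
    ((continuous_expTerm C T n).const_smul C |>.neg.neg.intervalIntegrable t T)
  simpa [expTerm] using h

theorem summable_expTerm (C T t : ℝ) : Summable fun n => expTerm C T n t :=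
  Real.summable_pow_div_factorial _

theorem tendsto_expTerm_zero (C T t : ℝ) : Tendsto (fun n => expTerm C T n t) atTop (𝓝 0) :=
  (summable_expTerm C T t).tendsto_atTop_zero

/-! ### Piecewise continuous functions and variation of constants -/

theorem isOpen_Ioo_sdiff_finset (a b : ℝ) (J : Finset ℝ) :
    IsOpen (Set.Ioo a b \ (J : Set ℝ)) :=
  isOpen_Ioo.sdiff J.finite_toSet.isClosed

/-- `f` is piecewise continuous on `[a, b]`: it is bounded there, and continuous on `(a, b)` off the
finite set `J`. One-sided limits at the points of `J` are not required. -/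
structure IsPiecewiseContinuous (J : Finset ℝ) (a b : ℝ) (f : ℝ → ℝ) : Prop where
  continuousOn : ContinuousOn f (Set.Ioo a b \ J)
  bounded : ∃ K, ∀ t ∈ Set.Icc a b, |f t| ≤ K

/-- The variation-of-constants formula for the solution of `y' = e y - q`, `y T = y₀`. -/
noncomputable def duhamel (T y₀ : ℝ) (e q : ℝ → ℝ) (t : ℝ) : ℝ :=
  y₀ * Real.exp (-∫ u in t..T, e u) + ∫ s in t..T, Real.exp (-∫ u in t..s, e u) * q s

namespace IsPiecewiseContinuous

variable {J : Finset ℝ} {a b : ℝ} {f g : ℝ → ℝ}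

theorem of_continuousOn (hf : ContinuousOn f (Set.Icc a b)) : IsPiecewiseContinuous J a b f :=
  ⟨hf.mono (Set.sdiff_subset.trans Set.Ioo_subset_Icc_self),
    isCompact_Icc.exists_bound_of_continuousOn hf⟩

theorem const (r : ℝ) : IsPiecewiseContinuous J a b fun _ => r :=
  of_continuousOn continuousOn_const

theorem add (hf : IsPiecewiseContinuous J a b f) (hg : IsPiecewiseContinuous J a b g) :
    IsPiecewiseContinuous J a b fun t => f t + g t := by
  obtain ⟨K, hK⟩ := hf.bounded
  obtain ⟨K', hK'⟩ := hg.bounded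
  exact ⟨hf.continuousOn.add hg.continuousOn, K + K', fun t ht =>
    (abs_add_le _ _).trans (add_le_add (hK t ht) (hK' t ht))⟩

theorem mul (hf : IsPiecewiseContinuous J a b f) (hg : IsPiecewiseContinuous J a b g) :
    IsPiecewiseContinuous J a b fun t => f t * g t := by
  obtain ⟨K, hK⟩ := hf.bounded
  obtain ⟨K', hK'⟩ := hg.bounded
  refine ⟨hf.continuousOn.mul hg.continuousOn, K * K', fun t ht => ?_⟩
  rw [abs_mul]
  exact mul_le_mul (hK t ht) (hK' t ht) (abs_nonneg _) ((abs_nonneg _).trans (hK t ht))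

theorem sum {ι : Type*} (s : Finset ι) {F : ι → ℝ → ℝ}
    (hF : ∀ i ∈ s, IsPiecewiseContinuous J a b (F i)) :
    IsPiecewiseContinuous J a b fun t => ∑ i ∈ s, F i t := by
  classical
  induction s using Finset.induction_on with
  | empty => simpa only [Finset.sum_empty] using const 0
  | insert i s hi ih =>
    simp only [Finset.sum_insert hi]
    exact (hF i (Finset.mem_insert_self i s)).add
      (ih fun j hj => hF j (Finset.mem_insert_of_mem hj))

theorem integrableOn (hf : IsPiecewiseContinuous J a b f) : IntegrableOn f (Set.Icc a b) := by
  obtain ⟨K, hK⟩ := hf.bounded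
  have hae : (Set.Ioo a b \ J : Set ℝ) =ᵐ[volume] Set.Icc a b :=
    (sdiff_null_ae_eq_self (J.finite_toSet.measure_zero _)).trans Ioo_ae_eq_Icc
  refine IntegrableOn.of_bound (C := K) measure_Icc_lt_top ?_
    ((ae_restrict_iff' measurableSet_Icc).2 (.of_forall hK))
  rw [← Measure.restrict_congr_set hae]
  exact hf.continuousOn.aestronglyMeasurable (isOpen_Ioo_sdiff_finset a b J).measurableSet

theorem intervalIntegrable (hf : IsPiecewiseContinuous J a b f) {s t : ℝ}
    (hs : s ∈ Set.Icc a b) (ht : t ∈ Set.Icc a b) : IntervalIntegrable f volume s t :=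
  (hf.integrableOn.mono_set (Set.uIcc_subset_Icc hs ht)).intervalIntegrable

theorem continuousOn_integral (hf : IsPiecewiseContinuous J a b f) :
    ContinuousOn (fun t => ∫ s in t..b, f s) (Set.Icc a b) := by
  rcases le_or_gt a b with h | h
  · rw [← Set.uIcc_of_le h]
    refine intervalIntegral.continuousOn_primitive_interval_left ?_
    rw [Set.uIcc_of_le h]
    exact hf.integrableOn
  · rw [Set.Icc_eq_empty h.not_ge]
    exact continuousOn_empty _

theorem hasDerivAt_integral (hf : IsPiecewiseContinuous J a b f) {t : ℝ}
    (ht : t ∈ Set.Ioo a b \ (J : Set ℝ)) : HasDerivAt (fun t => ∫ s in t..b, f s) (-f t) t :=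
  have hopen := isOpen_Ioo_sdiff_finset a b J
  intervalIntegral.integral_hasDerivAt_left
    (hf.intervalIntegrable ⟨ht.1.1.le, ht.1.2.le⟩ ⟨(ht.1.1.trans ht.1.2).le, le_rfl⟩)
    (hf.continuousOn.stronglyMeasurableAtFilter hopen t ht)
    (hf.continuousOn.continuousAt (hopen.mem_nhds ht))

theorem exp_integral (hf : IsPiecewiseContinuous J a b f) :
    IsPiecewiseContinuous J a b fun t => Real.exp (∫ s in t..b, f s) :=
  of_continuousOn hf.continuousOn_integral.rexp

theorem exp_neg_integral_eq_mul (hf : IsPiecewiseContinuous J a b f) {t s : ℝ}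
    (ht : t ∈ Set.Icc a b) (hs : s ∈ Set.Icc a b) : Real.exp (-∫ u in t..s, f u) =
      Real.exp (-∫ u in t..b, f u) * Real.exp (∫ u in s..b, f u) := by
  rw [← intervalIntegral.integral_add_adjacent_intervals (hf.intervalIntegrable ht hs)
    (hf.intervalIntegrable hs ⟨ht.1.trans ht.2, le_rfl⟩), ← Real.exp_add, neg_add,
    neg_add_cancel_right]

theorem intervalIntegrable_exp_neg_integral_mul (hf : IsPiecewiseContinuous J a b f)
    (hg : IsPiecewiseContinuous J a b g) {t : ℝ} (ht : t ∈ Set.Icc a b) :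
    IntervalIntegrable (fun s => Real.exp (-∫ u in t..s, f u) * g s) volume t b := by
  have hprod := ((const (Real.exp (-∫ u in t..b, f u))).mul hf.exp_integral).mul hg
  refine (hprod.intervalIntegrable ht ⟨ht.1.trans ht.2, le_rfl⟩).congr fun s hs => ?_
  rw [Set.uIoc_of_le ht.2] at hs
  simp only [hf.exp_neg_integral_eq_mul ht ⟨ht.1.trans hs.1.le, hs.2⟩]

theorem duhamel_eq_exp_mul (hf : IsPiecewiseContinuous J a b f) (y₀ : ℝ) {t : ℝ}
    (ht : t ∈ Set.Icc a b) : duhamel b y₀ f g t = Real.exp (-∫ u in t..b, f u) *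
      (y₀ + ∫ s in t..b, Real.exp (∫ u in s..b, f u) * g s) := by
  have hsplit : ∀ s ∈ Set.uIcc t b, Real.exp (-∫ u in t..s, f u) * g s =
      Real.exp (-∫ u in t..b, f u) * (Real.exp (∫ u in s..b, f u) * g s) := fun s hs => by
    rw [Set.uIcc_of_le ht.2] at hs
    rw [hf.exp_neg_integral_eq_mul ht ⟨ht.1.trans hs.1, hs.2⟩, mul_assoc]
  rw [duhamel, intervalIntegral.integral_congr hsplit, intervalIntegral.integral_const_mul]
  ring

theorem hasSum_duhamel (hf : IsPiecewiseContinuous J a b f) {F : ℕ → ℝ → ℝ} {bound : ℕ → ℝ}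
    (hF : ∀ n, IsPiecewiseContinuous J a b (F n))
    (hbound : ∀ n, ∀ s ∈ Set.Icc a b, |F n s| ≤ bound n) (hsummable : Summable bound)
    (hsum : ∀ s ∈ Set.Icc a b, HasSum (fun n => F n s) (g s)) {t : ℝ} (ht : t ∈ Set.Icc a b) :
    HasSum (fun n => duhamel b 0 f (F n) t) (duhamel b 0 f g t) := by
  obtain ⟨K, hK⟩ := hf.exp_integral.bounded
  have hIcc {s : ℝ} (hs : s ∈ Set.uIoc t b) : s ∈ Set.Icc a b := by
    rw [Set.uIoc_of_le ht.2] at hs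
    exact ⟨ht.1.trans hs.1.le, hs.2⟩
  have hb : b ∈ Set.Icc a b := ⟨ht.1.trans ht.2, le_rfl⟩
  simp only [hf.duhamel_eq_exp_mul 0 ht, zero_add]
  refine (intervalIntegral.hasSum_integral_of_dominated_convergence (fun n _ => K * bound n)
    (fun n => ((hf.exp_integral.mul (hF n)).intervalIntegrable ht hb).def'.aestronglyMeasurable)
    (fun n => .of_forall fun s hs => ?_) (.of_forall fun _ _ => hsummable.mul_left K)
    intervalIntegrable_const
    (.of_forall fun s hs => (hsum s (hIcc hs)).mul_left _)).mul_left _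
  rw [Real.norm_eq_abs, abs_mul]
  exact mul_le_mul (hK s (hIcc hs)) (hbound n s (hIcc hs)) (abs_nonneg _)
    ((abs_nonneg _).trans (hK s (hIcc hs)))

theorem continuousOn_duhamel (hf : IsPiecewiseContinuous J a b f)
    (hg : IsPiecewiseContinuous J a b g) (y₀ : ℝ) :
    ContinuousOn (duhamel b y₀ f g) (Set.Icc a b) :=
  (hf.continuousOn_integral.neg.rexp.mul
    (continuousOn_const.add (hf.exp_integral.mul hg).continuousOn_integral)).congr
    fun _ ht => hf.duhamel_eq_exp_mul y₀ ht

theorem hasDerivAt_duhamel (hf : IsPiecewiseContinuous J a b f)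
    (hg : IsPiecewiseContinuous J a b g) (y₀ : ℝ) {t : ℝ} (ht : t ∈ Set.Ioo a b \ (J : Set ℝ)) :
    HasDerivAt (duhamel b y₀ f g) (f t * duhamel b y₀ f g t - g t) t := by
  have hderiv := (hf.hasDerivAt_integral ht).neg.exp.mul
    (((hf.exp_integral.mul hg).hasDerivAt_integral ht).const_add y₀)
  refine (hderiv.congr_of_eventuallyEq ?_).congr_deriv ?_
  · filter_upwards [(isOpen_Ioo_sdiff_finset a b J).mem_nhds ht] with s hs
    exact hf.duhamel_eq_exp_mul y₀ (Set.Ioo_subset_Icc_self hs.1)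
  · have hexp : Real.exp (-∫ u in t..b, f u) * Real.exp (∫ u in t..b, f u) = 1 := by
      rw [← Real.exp_add, neg_add_cancel, Real.exp_zero]
    rw [hf.duhamel_eq_exp_mul y₀ (Set.Ioo_subset_Icc_self ht.1)]
    simp only [Pi.neg_apply]
    linear_combination (-g t) * hexp

end IsPiecewiseContinuous

/-! ### Cells, cylinders, and functions of timed paths -/

theorem SameCell.mono {J J' : Finset ℝ} (hJ : J ⊆ J') {s t : ℝ} (h : SameCell J' s t) :
    SameCell J s t := fun c hc => h c (hJ hc)

theorem SameCell.symm {J : Finset ℝ} {s t : ℝ} (h : SameCell J s t) : SameCell J t s :=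
  fun c hc => (h c hc).symm

theorem SameCell.trans {J : Finset ℝ} {r s t : ℝ} (h : SameCell J r s) (h' : SameCell J s t) :
    SameCell J r t := fun c hc => (h c hc).trans (h' c hc)

theorem eventually_sameCell {J : Finset ℝ} {s : ℝ} (hs : s ∉ J) :
    ∀ᶠ t in 𝓝 s, SameCell J t s := by
  refine (eventually_all_finset J).2 fun c hc => ?_
  rcases lt_or_gt_of_ne (ne_of_mem_of_not_mem hc hs) with h | h
  · filter_upwards [Ioi_mem_nhds h] with t ht
    exact iff_of_false (not_le.2 ht) (not_le.2 h)
  · filter_upwards [Iio_mem_nhds h] with t ht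
    exact iff_of_true (le_of_lt ht) h.le

namespace TimedPath

variable {L Act : Type*} {J J' : Finset ℝ} {T : ℝ}

theorem IsTimed.clock_nonneg : ∀ {π : TimedPath L Act}, π.IsTimed T → 0 ≤ π.clock
  | start _, _ => le_rfl
  | step _ _ _ _, h => (IsTimed.clock_nonneg h.1).trans h.2.1

theorem SameCylinder.refl : ∀ π : TimedPath L Act, SameCylinder J π π
  | start _ => rfl
  | step π _ _ _ => ⟨SameCylinder.refl π, rfl, fun _ _ => Iff.rfl, rfl⟩

theorem SameCylinder.mono (hJ : J ⊆ J') :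
    ∀ {π π' : TimedPath L Act}, SameCylinder J' π π' → SameCylinder J π π'
  | start _, start _, h => h
  | step _ _ _ _, step _ _ _ _, h => ⟨SameCylinder.mono hJ h.1, h.2.1, h.2.2.1.mono hJ, h.2.2.2⟩

theorem SameCylinder.last_eq :
    ∀ {π π' : TimedPath L Act}, SameCylinder J π π' → π.last = π'.last
  | start _, start _, h => h
  | step _ _ _ _, step _ _ _ _, h => h.2.2.2

theorem SameCylinder.visits_iff {G : Set L} :
    ∀ {π π' : TimedPath L Act}, SameCylinder J π π' → (π.Visits G ↔ π'.Visits G)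
  | start _, start _, h => by rw [Visits, Visits, show _ = _ from h]
  | step _ _ _ _, step _ _ _ _, h => or_congr (SameCylinder.visits_iff h.1) (by rw [h.2.2.2])

theorem visits_of_last_mem {G : Set L} : ∀ {π : TimedPath L Act}, π.last ∈ G → π.Visits G
  | start _, h => h
  | step _ _ _ _, h => Or.inr h

/-- A function `w` of a history and a time is regular if it is continuous in the time from the
last transition of the history on, and uniformly bounded. -/
structure IsRegular (T : ℝ) (w : TimedPath L Act → ℝ → ℝ) : Prop where
  continuousOn : ∀ π : TimedPath L Act, π.IsTimed T → ContinuousOn (w π) (Set.Icc π.clock T)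
  bounded : ∃ K, ∀ π : TimedPath L Act, π.IsTimed T → ∀ t ∈ Set.Icc π.clock T, |w π t| ≤ K

/-- The values of `w` depend on the history only through its cylindrification. -/
def IsCylinderInvariant {β : Type*} (J : Finset ℝ) (T : ℝ) (w : TimedPath L Act → ℝ → β) :
    Prop :=
  ∀ ⦃π π' : TimedPath L Act⦄, π.IsTimed T → π'.IsTimed T → SameCylinder J π π' →
    ∀ ⦃t⦄, t ∈ Set.Icc π.clock T → t ∈ Set.Icc π'.clock T → w π t = w π' t

variable {w w' : TimedPath L Act → ℝ → ℝ}

theorem IsRegular.sub (hw : IsRegular T w) (hw' : IsRegular T w') :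
    IsRegular T fun π t => w π t - w' π t where
  continuousOn π hπ := (hw.continuousOn π hπ).sub (hw'.continuousOn π hπ)
  bounded := by
    obtain ⟨K, hK⟩ := hw.bounded
    obtain ⟨K', hK'⟩ := hw'.bounded
    exact ⟨K + K', fun π hπ t ht =>
      (abs_sub _ _).trans (add_le_add (hK π hπ t ht) (hK' π hπ t ht))⟩

theorem IsRegular.const (r : ℝ) : IsRegular T fun (_ : TimedPath L Act) _ => r :=
  ⟨fun _ _ => continuousOn_const, |r|, fun _ _ _ _ => le_rfl⟩

/-- Near a time off `J`, moving the time of the last transition does not change the cylinder, so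
continuity for a fixed history suffices. -/
theorem IsRegular.isPiecewiseContinuous_step (hw : IsRegular T w)
    (hinv : IsCylinderInvariant J T w) {π : TimedPath L Act} (hπ : π.IsTimed T) (a : Act) (l : L) :
    IsPiecewiseContinuous J π.clock T fun s => w (π.step a s l) s := by
  refine ⟨fun s hs => ContinuousAt.continuousWithinAt ?_, ?_⟩
  · have hnear : ∀ᶠ u in 𝓝 s, SameCell J u s ∧ u ∈ Set.Ioo π.clock T :=
      (eventually_sameCell hs.2).and (isOpen_Ioo.mem_nhds hs.1)
    obtain ⟨r, ⟨hrcell, hr⟩, hrs⟩ :=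
      ((hnear.filter_mono nhdsWithin_le_nhds).and (self_mem_nhdsWithin (s := Set.Iio s))).exists
    have hrtimed : (π.step a r l).IsTimed T := ⟨hπ, hr.1.le, hr.2.le⟩
    refine ((hw.continuousOn _ hrtimed).continuousAt (Icc_mem_nhds hrs hs.1.2)).congr ?_
    filter_upwards [hnear, Ioi_mem_nhds hrs] with u ⟨hucell, hu⟩ hru
    exact @hinv (π.step a r l) (π.step a u l) hrtimed ⟨hπ, hu.1.le, hu.2.le⟩
      ⟨SameCylinder.refl π, rfl, hrcell.trans hucell.symm, rfl⟩ u
      ⟨le_of_lt hru, hu.2.le⟩ ⟨le_rfl, hu.2.le⟩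
  · obtain ⟨K, hK⟩ := hw.bounded
    exact ⟨K, fun t ht => hK (π.step a t l) ⟨hπ, ht.1, ht.2⟩ t ⟨le_rfl, ht.2⟩⟩

end TimedPath

namespace CTMDP

variable {L Act : Type*} [Fintype L] [Fintype Act] {M : CTMDP L Act}

/-! ### Sums over the transitions out of a location -/

/-- The sum of the exit rates of all locations and actions, a bound for every exit rate. -/
def totalRate (M : CTMDP L Act) : ℝ≥0 := ∑ l, ∑ a, M.exitRate l a

/-- The sum of `x a l'` over the transitions out of `l`, weighted with their rates when the action
`a` is chosen with weight `p a`. -/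
def rateSum (M : CTMDP L Act) (l : L) (p : Act → ℝ≥0) (x : Act → L → ℝ) : ℝ :=
  ∑ a, ∑ l', (p a * M.rate l a l' : ℝ) * x a l'

theorem rateSum_const (M : CTMDP L Act) (l : L) (p : Act → ℝ≥0) (c : ℝ) :
    M.rateSum l p (fun _ _ => c) = (∑ a, p a * M.exitRate l a : ℝ≥0) * c := by
  simp only [rateSum, exitRate, ← Finset.sum_mul, Finset.mul_sum, NNReal.coe_sum, NNReal.coe_mul]

theorem rateSum_sub (M : CTMDP L Act) (l : L) (p : Act → ℝ≥0) (x y : Act → L → ℝ) :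
    M.rateSum l p (fun a l' => x a l' - y a l') = M.rateSum l p x - M.rateSum l p y := by
  simp only [rateSum, mul_sub, Finset.sum_sub_distrib]

theorem rateSum_neg (M : CTMDP L Act) (l : L) (p : Act → ℝ≥0) (x : Act → L → ℝ) :
    M.rateSum l p (fun a l' => -x a l') = -M.rateSum l p x := by
  simp only [rateSum, mul_neg, Finset.sum_neg_distrib]

theorem rateSum_sub_const (M : CTMDP L Act) (l : L) (p : Act → ℝ≥0) (x : Act → L → ℝ) (c : ℝ) :
    M.rateSum l p (fun a l' => x a l' - c) =
      M.rateSum l p x - (∑ a, p a * M.exitRate l a : ℝ≥0) * c := by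
  rw [rateSum_sub, rateSum_const]

theorem rateSum_mono {l : L} {p : Act → ℝ≥0} {x y : Act → L → ℝ} (h : ∀ a l', x a l' ≤ y a l') :
    M.rateSum l p x ≤ M.rateSum l p y := by
  unfold rateSum
  gcongr with a _ l' _
  exact h a l'

theorem rateSum_nonneg {l : L} {p : Act → ℝ≥0} {x : Act → L → ℝ} (h : ∀ a l', 0 ≤ x a l') :
    0 ≤ M.rateSum l p x :=
  Finset.sum_nonneg fun _ _ => Finset.sum_nonneg fun _ _ => mul_nonneg (by positivity) (h _ _)

theorem ofReal_rateSum {l : L} {p : Act → ℝ≥0} {x : Act → L → ℝ} (h : ∀ a l', 0 ≤ x a l') :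
    ENNReal.ofReal (M.rateSum l p x) =
      ∑ a, ∑ l', ((p a * M.rate l a l' : ℝ≥0) : ℝ≥0∞) * ENNReal.ofReal (x a l') := by
  have hterm (a l') : 0 ≤ (p a * M.rate l a l' : ℝ) * x a l' := mul_nonneg (by positivity) (h a l')
  rw [rateSum, ENNReal.ofReal_sum_of_nonneg fun a _ => Finset.sum_nonneg fun l' _ => hterm a l']
  refine Finset.sum_congr rfl fun a _ => ?_
  rw [ENNReal.ofReal_sum_of_nonneg fun l' _ => hterm a l']
  refine Finset.sum_congr rfl fun l' _ => ?_
  rw [← NNReal.coe_mul, ENNReal.ofReal_mul (NNReal.coe_nonneg _), ENNReal.ofReal_coe_nnreal]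

namespace Scheduler

variable {S : M.Scheduler} {J : Finset ℝ} {T : ℝ}

theorem prob_le_one (S : M.Scheduler) (π : TimedPath L Act) (t : ℝ) (a : Act) :
    S.prob π t a ≤ 1 := by
  rw [← S.sum_eq_one π t]
  exact Finset.single_le_sum (f := S.prob π t) (fun _ _ => zero_le) (Finset.mem_univ a)

theorem exitRate_le (S : M.Scheduler) (π : TimedPath L Act) (t : ℝ) :
    S.exitRate π t ≤ M.totalRate :=
  calc S.exitRate π t ≤ ∑ a, M.exitRate π.last a :=
        Finset.sum_le_sum fun a _ => mul_le_of_le_one_left' (S.prob_le_one π t a)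
    _ ≤ M.totalRate := Finset.single_le_sum (f := fun l => ∑ a, M.exitRate l a)
        (fun _ _ => zero_le) (Finset.mem_univ _)

/-- The total flow into `w` out of the history `π`: its values after one further transition,
weighted with the rates at time `t`. -/
def jump (S : M.Scheduler) (w : TimedPath L Act → ℝ → ℝ) (π : TimedPath L Act) (t : ℝ) : ℝ :=
  M.rateSum π.last (S.prob π t) fun a k => w (π.step a t k) t

/-- The generator of the process controlled by `S`, acting on functions of histories. -/
def generator (S : M.Scheduler) (w : TimedPath L Act → ℝ → ℝ) (π : TimedPath L Act) (t : ℝ) : ℝ :=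
  M.rateSum π.last (S.prob π t) fun a k => w (π.step a t k) t - w π t

theorem generator_eq_jump_sub (S : M.Scheduler) (w : TimedPath L Act → ℝ → ℝ)
    (π : TimedPath L Act) (t : ℝ) :
    S.generator w π t = S.jump w π t - S.exitRate π t * w π t :=
  M.rateSum_sub_const _ _ _ _

theorem generator_sub (S : M.Scheduler) (w w' : TimedPath L Act → ℝ → ℝ) (π : TimedPath L Act)
    (t : ℝ) : S.generator (fun π t => w π t - w' π t) π t =
      S.generator w π t - S.generator w' π t := by
  simp only [generator, ← rateSum_sub, sub_sub_sub_comm]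

theorem generator_const (S : M.Scheduler) (c : ℝ) (π : TimedPath L Act) (t : ℝ) :
    S.generator (fun _ _ => c) π t = 0 := by
  simp only [generator, sub_self, rateSum_const, mul_zero]

theorem jump_nonneg {w : TimedPath L Act → ℝ → ℝ} {π : TimedPath L Act} {t : ℝ}
    (hw : ∀ a l', 0 ≤ w (π.step a t l') t) : 0 ≤ S.jump w π t := rateSum_nonneg hw

/-- Uniformization: adding self-loops makes every exit rate equal to `totalRate`. -/
theorem generator_add_le {w : TimedPath L Act → ℝ → ℝ} {π : TimedPath L Act} {t c : ℝ}
    (hc : w π t ≤ c) (hstep : ∀ a l', w (π.step a t l') t ≤ c) :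
    S.generator w π t + M.totalRate * w π t ≤ M.totalRate * c := by
  have hexit : (S.exitRate π t : ℝ) ≤ M.totalRate := S.exitRate_le π t
  have hjump : S.jump w π t ≤ S.exitRate π t * c :=
    (rateSum_mono hstep).trans_eq (M.rateSum_const _ _ _)
  rw [generator_eq_jump_sub]
  linarith [mul_le_mul_of_nonneg_left hc (sub_nonneg.2 hexit)]

/-! ### The comparison principle for the backward equation -/

/-- `w` is a subsolution of the backward equation `-w' = S.generator w`. -/
structure IsSubsolution (S : M.Scheduler) (J : Finset ℝ) (T : ℝ)
    (w : TimedPath L Act → ℝ → ℝ) : Prop extends TimedPath.IsRegular T w where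
  hasDerivAt : ∀ π : TimedPath L Act, π.IsTimed T → ∀ t ∈ Set.Ioo π.clock T \ (J : Set ℝ),
    ∃ d, HasDerivAt (w π) d t ∧ -S.generator w π t ≤ d

/-- `w` is a supersolution of the backward equation `-w' = S.generator w`. -/
structure IsSupersolution (S : M.Scheduler) (J : Finset ℝ) (T : ℝ)
    (w : TimedPath L Act → ℝ → ℝ) : Prop extends TimedPath.IsRegular T w where
  hasDerivAt : ∀ π : TimedPath L Act, π.IsTimed T → ∀ t ∈ Set.Ioo π.clock T \ (J : Set ℝ),
    ∃ d, HasDerivAt (w π) d t ∧ d ≤ -S.generator w π t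

theorem isSupersolution_const (S : M.Scheduler) (J : Finset ℝ) (T c : ℝ) :
    S.IsSupersolution J T fun _ _ => c where
  toIsRegular := .const c
  hasDerivAt _ _ _ _ := ⟨0, hasDerivAt_const _ _, by rw [generator_const, neg_zero]⟩

theorem IsSubsolution.sub {v w : TimedPath L Act → ℝ → ℝ} (hv : S.IsSubsolution J T v)
    (hw : S.IsSupersolution J T w) : S.IsSubsolution J T fun π t => v π t - w π t where
  toIsRegular := hv.toIsRegular.sub hw.toIsRegular
  hasDerivAt π hπ t ht := by
    obtain ⟨v', hv', hle⟩ := hv.hasDerivAt π hπ t ht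
    obtain ⟨w', hw', hge⟩ := hw.hasDerivAt π hπ t ht
    exact ⟨v' - w', hv'.sub hw', by rw [generator_sub]; linarith⟩

theorem IsSubsolution.le_exp_mul_expTerm_succ {w : TimedPath L Act → ℝ → ℝ}
    (hw : S.IsSubsolution J T w)
    (hterm : ∀ π : TimedPath L Act, π.IsTimed T → π.clock ≤ T → w π T ≤ 0) {K : ℝ} {n : ℕ}
    (hn : ∀ π : TimedPath L Act, π.IsTimed T → ∀ t ∈ Set.Icc π.clock T,
      w π t ≤ Real.exp (M.totalRate * t) * (K * expTerm M.totalRate T n t))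
    {π : TimedPath L Act} (hπ : π.IsTimed T) {t : ℝ} (ht : t ∈ Set.Icc π.clock T) :
    w π t ≤ Real.exp (M.totalRate * t) * (K * expTerm M.totalRate T (n + 1) t) := by
  have hexp (s : ℝ) : Real.exp (-M.totalRate * s) * Real.exp (M.totalRate * s) = 1 := by
    rw [← Real.exp_add, neg_mul, neg_add_cancel, Real.exp_zero]
  have hmono := le_of_hasDerivAt_nonneg_off_finset J ht.2
    (g := fun s => Real.exp (-M.totalRate * s) * w π s - K * expTerm M.totalRate T (n + 1) s)
    ?_ fun s hs => ?_
  · have hlast : Real.exp (-M.totalRate * T) * w π T ≤ 0 :=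
      mul_nonpos_of_nonneg_of_nonpos (Real.exp_pos _).le (hterm π hπ (ht.1.trans ht.2))
    have hzero : expTerm M.totalRate T (n + 1) T = 0 := by simp [expTerm]
    have hle : Real.exp (-M.totalRate * t) * w π t ≤ K * expTerm M.totalRate T (n + 1) t := by
      simp only [hzero] at hmono
      linarith
    linear_combination mul_le_mul_of_nonneg_left hle (Real.exp_pos (M.totalRate * t)).le -
      w π t * hexp t
  · exact ((by fun_prop : Continuous fun s : ℝ => Real.exp (-M.totalRate * s)).continuousOn.mul
      ((hw.continuousOn π hπ).mono (Set.Icc_subset_Icc_left ht.1))).sub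
      (continuous_const.mul (continuous_expTerm _ _ _)).continuousOn
  · have hs' : s ∈ Set.Ioo π.clock T := ⟨ht.1.trans_lt hs.1.1, hs.1.2⟩
    obtain ⟨w', hw', hle⟩ := hw.hasDerivAt π hπ s ⟨hs', hs.2⟩
    refine ⟨_, (hasDerivAt_exp_neg_mul M.totalRate hw').sub
      ((hasDerivAt_expTerm_succ _ _ _ _).const_mul K), ?_⟩
    have hgen := generator_add_le (S := S) (hn π hπ s ⟨hs'.1.le, hs'.2.le⟩)
      fun a l' => hn (π.step a s l') ⟨hπ, hs'.1.le, hs'.2.le⟩ s ⟨le_rfl, hs'.2.le⟩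
    have hdecay : -(M.totalRate * (Real.exp (M.totalRate * s) *
        (K * expTerm M.totalRate T n s))) ≤ w' - M.totalRate * w π s := by linarith
    linear_combination mul_le_mul_of_nonneg_left hdecay (Real.exp_pos (-M.totalRate * s)).le +
      (M.totalRate * (K * expTerm M.totalRate T n s)) * hexp s

theorem IsSubsolution.nonpos {w : TimedPath L Act → ℝ → ℝ} (hw : S.IsSubsolution J T w)
    (hterm : ∀ π : TimedPath L Act, π.IsTimed T → π.clock ≤ T → w π T ≤ 0)
    {π : TimedPath L Act} (hπ : π.IsTimed T) {t : ℝ} (ht : t ∈ Set.Icc π.clock T) : w π t ≤ 0 := by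
  obtain ⟨K, hK⟩ := hw.bounded
  have hbound (n : ℕ) : ∀ π : TimedPath L Act, π.IsTimed T → ∀ t ∈ Set.Icc π.clock T,
      w π t ≤ Real.exp (M.totalRate * t) * (K * expTerm M.totalRate T n t) := by
    induction n with
    | zero =>
      intro π hπ t ht
      rw [expTerm_zero, mul_one]
      refine (le_abs_self _).trans ((hK π hπ t ht).trans (le_mul_of_one_le_left
        ((abs_nonneg _).trans (hK π hπ t ht)) (Real.one_le_exp ?_)))
      exact mul_nonneg M.totalRate.coe_nonneg (hπ.clock_nonneg.trans ht.1)
    | succ n ih => exact fun π hπ t ht => hw.le_exp_mul_expTerm_succ hterm ih hπ ht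
  have hlim : Tendsto (fun n => Real.exp (M.totalRate * t) * (K * expTerm M.totalRate T n t))
      atTop (𝓝 0) := by
    simpa only [mul_zero] using
      ((tendsto_expTerm_zero M.totalRate T t).const_mul K).const_mul (Real.exp (M.totalRate * t))
  exact ge_of_tendsto' hlim fun n => hbound n π hπ t ht

theorem IsSubsolution.le_of_isSupersolution {v w : TimedPath L Act → ℝ → ℝ}
    (hv : S.IsSubsolution J T v) (hw : S.IsSupersolution J T w)
    (hterm : ∀ π : TimedPath L Act, π.IsTimed T → π.clock ≤ T → v π T ≤ w π T)
    {π : TimedPath L Act} (hπ : π.IsTimed T) {t : ℝ} (ht : t ∈ Set.Icc π.clock T) :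
    v π t ≤ w π t :=
  sub_nonpos.1 ((hv.sub hw).nonpos (fun π hπ hT => sub_nonpos.2 (hterm π hπ hT)) hπ ht)

/-! ### Cylindrical schedulers and the law of the path -/

/-- `S` is cylindrical with respect to the partition of `[0, T]` with endpoints `J`. Unlike in
`IsCylindrical`, the points of `J` may lie outside of `[0, T]`. -/
def IsCylindricalFor (S : M.Scheduler) (J : Finset ℝ) (T : ℝ) : Prop :=
  ∀ π π' : TimedPath L Act, ∀ t ∈ Set.Icc 0 T, ∀ t' ∈ Set.Icc 0 T,
    π.IsTimed T → π'.IsTimed T → TimedPath.SameCylinder J π π' → SameCell J t t' →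
      S.prob π t = S.prob π' t'

theorem IsCylindrical.exists_isCylindricalFor (hS : S.IsCylindrical T) :
    ∃ J, S.IsCylindricalFor J T :=
  let ⟨J, _, _, hJ⟩ := hS
  ⟨J, hJ⟩

theorem survival_le_one (S : M.Scheduler) (π : TimedPath L Act) {t s : ℝ} (h : t ≤ s) :
    S.survival π t s ≤ 1 := by
  rw [survival, ENNReal.ofReal_le_one, Real.exp_le_one_iff, neg_nonpos]
  exact intervalIntegral.integral_nonneg h fun _ _ => NNReal.coe_nonneg _

theorem jump_le_totalRate_mul {w : TimedPath L Act → ℝ → ℝ} {π : TimedPath L Act} {t c : ℝ}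
    (hc : 0 ≤ c) (hw : ∀ a l', w (π.step a t l') t ≤ c) : S.jump w π t ≤ M.totalRate * c :=
  calc S.jump w π t ≤ S.exitRate π t * c := (rateSum_mono hw).trans_eq (M.rateSum_const _ _ _)
    _ ≤ M.totalRate * c := mul_le_mul_of_nonneg_right (S.exitRate_le π t) hc

theorem pathProb_le_expTerm (S : M.Scheduler) (A : Set (TimedPath L Act)) (n : ℕ) :
    ∀ (π : TimedPath L Act) {t : ℝ}, t ≤ T →
      S.pathProb T A n π t ≤ ENNReal.ofReal (expTerm M.totalRate T n t) := by
  induction n with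
  | zero =>
    intro π t ht
    rw [pathProb, expTerm_zero, ENNReal.ofReal_one]
    exact mul_le_one' (Set.indicator_le_self' (fun _ _ => zero_le) π) (S.survival_le_one π ht)
  | succ n ih =>
    intro π t ht
    have hnonneg {s : ℝ} (hs : s ≤ T) : 0 ≤ expTerm M.totalRate T n s :=
      expTerm_nonneg M.totalRate.coe_nonneg hs n
    have hcont : Continuous fun s => M.totalRate * expTerm M.totalRate T n s :=
      continuous_const.mul (continuous_expTerm _ T n)
    rw [← integral_expTerm, intervalIntegral.integral_of_le ht,
      ofReal_integral_eq_lintegral_ofReal (hcont.intervalIntegrable t T).1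
        ((ae_restrict_iff' measurableSet_Ioc).2
          (.of_forall fun s hs => mul_nonneg M.totalRate.coe_nonneg (hnonneg hs.2)))]
    refine setLIntegral_mono' measurableSet_Ioc fun s hs => ?_
    calc _ ≤ ∑ a, ∑ l', ((S.prob π s a * M.rate π.last a l' : ℝ≥0) : ℝ≥0∞) *
            S.pathProb T A n (π.step a s l') s :=
          mul_le_of_le_one_left' (S.survival_le_one π hs.1.le)
      _ ≤ ∑ a, ∑ l', ((S.prob π s a * M.rate π.last a l' : ℝ≥0) : ℝ≥0∞) *
            ENNReal.ofReal (expTerm M.totalRate T n s) := by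
          gcongr with a _ l' _
          exact ih _ hs.2
      _ = ENNReal.ofReal (S.jump (fun _ s => expTerm M.totalRate T n s) π s) :=
          (ofReal_rateSum fun _ _ => hnonneg hs.2).symm
      _ ≤ ENNReal.ofReal (M.totalRate * expTerm M.totalRate T n s) :=
          ENNReal.ofReal_le_ofReal (jump_le_totalRate_mul (hnonneg hs.2) fun _ _ => le_rfl)

theorem pathProb_ne_top (S : M.Scheduler) (A : Set (TimedPath L Act)) (n : ℕ)
    (π : TimedPath L Act) {t : ℝ} (ht : t ≤ T) : S.pathProb T A n π t ≠ ∞ :=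
  ((S.pathProb_le_expTerm A n π ht).trans_lt ENNReal.ofReal_lt_top).ne

namespace IsCylindricalFor

theorem mono {J' : Finset ℝ} (hS : S.IsCylindricalFor J T) (hJ : J ⊆ J') :
    S.IsCylindricalFor J' T := fun π π' t ht t' ht' hπ hπ' h h' =>
  hS π π' t ht t' ht' hπ hπ' (h.mono hJ) (h'.mono hJ)

theorem isCylinderInvariant_prob (hS : S.IsCylindricalFor J T) :
    TimedPath.IsCylinderInvariant J T S.prob := fun π π' hπ hπ' h t ht _ =>
  have ht₀ : t ∈ Set.Icc 0 T := ⟨hπ.clock_nonneg.trans ht.1, ht.2⟩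
  hS π π' t ht₀ t ht₀ hπ hπ' h fun _ _ => Iff.rfl

theorem survival_eq (hS : S.IsCylindricalFor J T) {π π' : TimedPath L Act} (hπ : π.IsTimed T)
    (hπ' : π'.IsTimed T) (h : TimedPath.SameCylinder J π π') {t s : ℝ} (hts : t ≤ s) (hsT : s ≤ T)
    (ht : π.clock ≤ t) (ht' : π'.clock ≤ t) : S.survival π t s = S.survival π' t s := by
  rw [survival, survival, intervalIntegral.integral_congr fun u hu => ?_]
  rw [Set.uIcc_of_le hts] at hu
  simp only [exitRate, h.last_eq, hS.isCylinderInvariant_prob hπ hπ' h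
    ⟨ht.trans hu.1, hu.2.trans hsT⟩ ⟨ht'.trans hu.1, hu.2.trans hsT⟩]

theorem isCylinderInvariant_pathProb (hS : S.IsCylindricalFor J T) {A : Set (TimedPath L Act)}
    (hA : ∀ π π', TimedPath.SameCylinder J π π' → (π ∈ A ↔ π' ∈ A)) (n : ℕ) :
    TimedPath.IsCylinderInvariant J T (S.pathProb T A n) := by
  classical
  induction n with
  | zero =>
    intro π π' hπ hπ' h t ht ht'
    simp only [pathProb, hS.survival_eq hπ hπ' h ht.2 le_rfl ht.1 ht'.1, Set.indicator_apply,
      hA π π' h]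
  | succ n ih =>
    intro π π' hπ hπ' h t ht ht'
    refine setLIntegral_congr_fun measurableSet_Ioc fun s hs => ?_
    have hc : π.clock ≤ s := ht.1.trans hs.1.le
    have hc' : π'.clock ≤ s := ht'.1.trans hs.1.le
    have hstep (a : Act) (l' : L) :
        S.pathProb T A n (π.step a s l') s = S.pathProb T A n (π'.step a s l') s :=
      @ih (π.step a s l') (π'.step a s l') ⟨hπ, hc, hs.2⟩ ⟨hπ', hc', hs.2⟩
        ⟨h, rfl, fun _ _ => Iff.rfl, rfl⟩ s ⟨le_rfl, hs.2⟩ ⟨le_rfl, hs.2⟩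
    simp only [hS.survival_eq hπ hπ' h hs.1.le hs.2 ht.1 ht'.1, h.last_eq, hstep,
      hS.isCylinderInvariant_prob hπ hπ' h ⟨hc, hs.2⟩ ⟨hc', hs.2⟩]

variable {π : TimedPath L Act}

theorem isPiecewiseContinuous_prob (hS : S.IsCylindricalFor J T) (hπ : π.IsTimed T) (a : Act) :
    IsPiecewiseContinuous J π.clock T fun t => (S.prob π t a : ℝ) := by
  refine ⟨fun t ht => ContinuousAt.continuousWithinAt ?_, 1, fun t _ => ?_⟩
  · have hIcc {s : ℝ} (hs : s ∈ Set.Ioo π.clock T) : s ∈ Set.Icc 0 T :=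
      ⟨hπ.clock_nonneg.trans hs.1.le, hs.2.le⟩
    refine (continuousAt_const (y := (S.prob π t a : ℝ))).congr ?_
    filter_upwards [eventually_sameCell ht.2, isOpen_Ioo.mem_nhds ht.1] with s hcell hs
    rw [hS π π s (hIcc hs) t (hIcc ht.1) hπ hπ (.refl π) hcell]
  · rw [abs_of_nonneg (NNReal.coe_nonneg _)]
    exact_mod_cast S.prob_le_one π t a

theorem isPiecewiseContinuous_exitRate (hS : S.IsCylindricalFor J T) (hπ : π.IsTimed T) :
    IsPiecewiseContinuous J π.clock T fun t => (S.exitRate π t : ℝ) := by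
  simp only [exitRate, NNReal.coe_sum, NNReal.coe_mul]
  exact .sum _ fun a _ => (hS.isPiecewiseContinuous_prob hπ a).mul (.const _)

theorem isPiecewiseContinuous_jump (hS : S.IsCylindricalFor J T) {w : TimedPath L Act → ℝ → ℝ}
    (hw : TimedPath.IsRegular T w) (hinv : TimedPath.IsCylinderInvariant J T w)
    (hπ : π.IsTimed T) : IsPiecewiseContinuous J π.clock T (S.jump w π) :=
  .sum _ fun a _ => .sum _ fun l' _ => ((hS.isPiecewiseContinuous_prob hπ a).mul (.const _)).mul
    (hw.isPiecewiseContinuous_step hinv hπ a l')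

end IsCylindricalFor

end Scheduler

/-! ### The reachability probability solves the backward equation -/

/-- The indicator function of the histories that have visited the goal region. -/
noncomputable def visited (M : CTMDP L Act) (π : TimedPath L Act) : ℝ :=
  {ρ : TimedPath L Act | ρ.Visits M.goal}.indicator 1 π

theorem visited_of_visits {π : TimedPath L Act} (h : π.Visits M.goal) : M.visited π = 1 :=
  Set.indicator_of_mem (s := {ρ : TimedPath L Act | ρ.Visits M.goal}) h 1

theorem visited_of_not_visits {π : TimedPath L Act} (h : ¬π.Visits M.goal) : M.visited π = 0 :=
  Set.indicator_of_notMem (s := {ρ : TimedPath L Act | ρ.Visits M.goal}) h 1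

theorem visited_nonneg (M : CTMDP L Act) (π : TimedPath L Act) : 0 ≤ M.visited π :=
  Set.indicator_nonneg (fun _ _ => zero_le_one) π

theorem visited_le_one (M : CTMDP L Act) (π : TimedPath L Act) : M.visited π ≤ 1 :=
  Set.indicator_le_self' (fun _ _ => zero_le_one) π

theorem visited_le_visited_step (M : CTMDP L Act) (π : TimedPath L Act) (a : Act) (t : ℝ) (l : L) :
    M.visited π ≤ M.visited (π.step a t l) := by
  by_cases h : π.Visits M.goal
  · rw [visited_of_visits h, visited_of_visits (π := π.step a t l) (Or.inl h)]
  · exact (visited_of_not_visits h).trans_le (M.visited_nonneg _)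

namespace Scheduler

/-- The probability of visiting the goal region on a path with exactly `n` further transitions. -/
noncomputable def visitProb (S : M.Scheduler) (T : ℝ) (n : ℕ) (π : TimedPath L Act) (t : ℝ) : ℝ :=
  (S.pathProb T {ρ | ρ.Visits M.goal} n π t).toReal

theorem visitProb_nonneg (S : M.Scheduler) (n : ℕ) (π : TimedPath L Act) (t : ℝ) :
    0 ≤ S.visitProb T n π t := ENNReal.toReal_nonneg

theorem visitProb_le_expTerm (S : M.Scheduler) (n : ℕ) (π : TimedPath L Act) {t : ℝ} (ht : t ≤ T) :
    S.visitProb T n π t ≤ expTerm M.totalRate T n t :=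
  ENNReal.toReal_le_of_le_ofReal (expTerm_nonneg M.totalRate.coe_nonneg ht n)
    (S.pathProb_le_expTerm _ n π ht)

theorem visitProb_le_expTerm_zero (S : M.Scheduler) (n : ℕ) (π : TimedPath L Act) {t : ℝ}
    (ht : t ∈ Set.Icc 0 T) : S.visitProb T n π t ≤ expTerm M.totalRate T n 0 :=
  (S.visitProb_le_expTerm n π ht.2).trans
    (expTerm_antitone M.totalRate.coe_nonneg ht.1 ht.2 n)

theorem abs_visitProb_le (S : M.Scheduler) (n : ℕ) {π : TimedPath L Act} (hπ : π.IsTimed T) {t : ℝ}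
    (ht : t ∈ Set.Icc π.clock T) : |S.visitProb T n π t| ≤ expTerm M.totalRate T n 0 := by
  rw [abs_of_nonneg (S.visitProb_nonneg n π t)]
  exact S.visitProb_le_expTerm_zero n π ⟨hπ.clock_nonneg.trans ht.1, ht.2⟩

theorem reachProbFrom_nonneg (S : M.Scheduler) (T : ℝ) (π : TimedPath L Act) (t : ℝ) :
    0 ≤ S.reachProbFrom T π t := ENNReal.toReal_nonneg

theorem hasSum_visitProb (S : M.Scheduler) (π : TimedPath L Act) {t : ℝ} (ht : t ≤ T) :
    HasSum (fun n => S.visitProb T n π t) (S.reachProbFrom T π t) := by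
  rw [reachProbFrom, ENNReal.tsum_toReal_eq fun n => S.pathProb_ne_top _ n π ht]
  exact ((summable_expTerm M.totalRate T t).of_nonneg_of_le (fun n => S.visitProb_nonneg n π t)
    fun n => S.visitProb_le_expTerm n π ht).hasSum

theorem hasSum_jump_visitProb (S : M.Scheduler) (π : TimedPath L Act) {t : ℝ} (ht : t ≤ T) :
    HasSum (fun n => S.jump (S.visitProb T n) π t) (S.jump (S.reachProbFrom T) π t) :=
  hasSum_sum fun _ _ => hasSum_sum fun _ _ => (S.hasSum_visitProb _ ht).mul_left _

theorem visitProb_zero_eq_duhamel (S : M.Scheduler) (T : ℝ) (π : TimedPath L Act) :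
    S.visitProb T 0 π = duhamel T (M.visited π) (fun u => S.exitRate π u) 0 := by
  classical
  ext t
  have hsurvival : (S.survival π t T).toReal = Real.exp (-∫ u in t..T, (S.exitRate π u : ℝ)) :=
    ENNReal.toReal_ofReal (Real.exp_pos _).le
  rw [visitProb, pathProb, ENNReal.toReal_mul, hsurvival]
  by_cases h : π.Visits M.goal <;> simp [duhamel, visited, h]

namespace IsCylindricalFor

variable {S : M.Scheduler} {J : Finset ℝ} {T : ℝ} {π : TimedPath L Act} {t : ℝ} {n : ℕ}

theorem visitProb_succ_eq_duhamel (hS : S.IsCylindricalFor J T)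
    (hjump : IsPiecewiseContinuous J π.clock T (S.jump (S.visitProb T n) π))
    (hπ : π.IsTimed T) (ht : t ∈ Set.Icc π.clock T) : S.visitProb T (n + 1) π t =
      duhamel T 0 (fun u => S.exitRate π u) (S.jump (S.visitProb T n) π) t := by
  have hint := (hS.isPiecewiseContinuous_exitRate hπ).intervalIntegrable_exp_neg_integral_mul
    hjump ht
  rw [duhamel, zero_mul, zero_add, intervalIntegral.integral_of_le ht.2,
    integral_eq_lintegral_of_nonneg_ae (.of_forall fun s => mul_nonneg (Real.exp_pos _).le
      (jump_nonneg fun _ _ => S.visitProb_nonneg n _ _)) hint.1.aestronglyMeasurable,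
    visitProb, pathProb]
  congr 1
  refine setLIntegral_congr_fun measurableSet_Ioc fun s hs => ?_
  rw [ENNReal.ofReal_mul (Real.exp_pos _).le, survival, jump,
    ofReal_rateSum fun _ _ => S.visitProb_nonneg n _ _]
  simp only [visitProb, ENNReal.ofReal_toReal (S.pathProb_ne_top _ n _ hs.2)]

theorem isCylinderInvariant_visitProb (hS : S.IsCylindricalFor J T) (n : ℕ) :
    TimedPath.IsCylinderInvariant J T (S.visitProb T n) := fun _ _ hπ hπ' h _ ht ht' =>
  congrArg ENNReal.toReal
    (hS.isCylinderInvariant_pathProb (fun _ _ h => h.visits_iff) n hπ hπ' h ht ht')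

theorem isCylinderInvariant_reachProbFrom (hS : S.IsCylindricalFor J T) :
    TimedPath.IsCylinderInvariant J T (S.reachProbFrom T) := fun _ _ hπ hπ' h _ ht ht' =>
  congrArg ENNReal.toReal (tsum_congr fun n =>
    hS.isCylinderInvariant_pathProb (fun _ _ h => h.visits_iff) n hπ hπ' h ht ht')

theorem isRegular_visitProb (hS : S.IsCylindricalFor J T) (n : ℕ) :
    TimedPath.IsRegular T (S.visitProb T n) where
  continuousOn := by
    induction n with
    | zero =>
      intro π hπ
      rw [visitProb_zero_eq_duhamel]
      exact (hS.isPiecewiseContinuous_exitRate hπ).continuousOn_duhamel (.const 0) _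
    | succ n ih =>
      intro π hπ
      have hjump := hS.isPiecewiseContinuous_jump
        ⟨ih, _, fun π hπ t => S.abs_visitProb_le n hπ⟩ (hS.isCylinderInvariant_visitProb n) hπ
      exact ((hS.isPiecewiseContinuous_exitRate hπ).continuousOn_duhamel hjump 0).congr
        fun t ht => hS.visitProb_succ_eq_duhamel hjump hπ ht
  bounded := ⟨_, fun _ hπ _ => S.abs_visitProb_le n hπ⟩

theorem isPiecewiseContinuous_jump_visitProb (hS : S.IsCylindricalFor J T) (hπ : π.IsTimed T)
    (n : ℕ) : IsPiecewiseContinuous J π.clock T (S.jump (S.visitProb T n) π) :=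
  hS.isPiecewiseContinuous_jump (hS.isRegular_visitProb n) (hS.isCylinderInvariant_visitProb n) hπ

theorem isRegular_reachProbFrom (hS : S.IsCylindricalFor J T) :
    TimedPath.IsRegular T (S.reachProbFrom T) where
  continuousOn π hπ :=
    (continuousOn_tsum (fun n => (hS.isRegular_visitProb n).continuousOn π hπ)
      (summable_expTerm M.totalRate T 0) fun n _ ht => S.abs_visitProb_le n hπ ht).congr
        fun _ ht => (S.hasSum_visitProb π ht.2).tsum_eq.symm
  bounded := ⟨∑' n, expTerm M.totalRate T n 0, fun π hπ t ht => by
    rw [abs_of_nonneg (S.reachProbFrom_nonneg T π t)]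
    exact hasSum_le (fun n => (le_abs_self _).trans (S.abs_visitProb_le n hπ ht))
      (S.hasSum_visitProb π ht.2) (summable_expTerm M.totalRate T 0).hasSum⟩

theorem isPiecewiseContinuous_jump_reachProbFrom (hS : S.IsCylindricalFor J T)
    (hπ : π.IsTimed T) : IsPiecewiseContinuous J π.clock T (S.jump (S.reachProbFrom T) π) :=
  hS.isPiecewiseContinuous_jump hS.isRegular_reachProbFrom hS.isCylinderInvariant_reachProbFrom hπ

theorem hasSum_visitProb_succ (hS : S.IsCylindricalFor J T) (hπ : π.IsTimed T)
    (ht : t ∈ Set.Icc π.clock T) : HasSum (fun n => S.visitProb T (n + 1) π t)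
      (duhamel T 0 (fun u => S.exitRate π u) (S.jump (S.reachProbFrom T) π) t) := by
  have hbound (n : ℕ) (s : ℝ) (hs : s ∈ Set.Icc π.clock T) :
      |S.jump (S.visitProb T n) π s| ≤ M.totalRate * expTerm M.totalRate T n 0 := by
    have hs₀ : s ∈ Set.Icc 0 T := ⟨hπ.clock_nonneg.trans hs.1, hs.2⟩
    rw [abs_of_nonneg (jump_nonneg fun _ _ => S.visitProb_nonneg n _ _)]
    exact jump_le_totalRate_mul (expTerm_nonneg M.totalRate.coe_nonneg (hs₀.1.trans hs₀.2) n)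
      fun _ _ => S.visitProb_le_expTerm_zero n _ hs₀
  have hjump := hS.isPiecewiseContinuous_jump_visitProb hπ
  simp only [hS.visitProb_succ_eq_duhamel (hjump _) hπ ht]
  exact (hS.isPiecewiseContinuous_exitRate hπ).hasSum_duhamel hjump hbound
    ((summable_expTerm M.totalRate T 0).mul_left _) (fun s hs => S.hasSum_jump_visitProb π hs.2) ht

theorem reachProbFrom_eq_duhamel (hS : S.IsCylindricalFor J T) (hπ : π.IsTimed T)
    (ht : t ∈ Set.Icc π.clock T) : S.reachProbFrom T π t =
      duhamel T (M.visited π) (fun u => S.exitRate π u) (S.jump (S.reachProbFrom T) π) t := by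
  have hsum := (hS.hasSum_visitProb_succ hπ ht).zero_add (f := fun n => S.visitProb T n π t)
  rw [(S.hasSum_visitProb π ht.2).unique hsum, visitProb_zero_eq_duhamel]
  simp only [duhamel, Pi.zero_apply, mul_zero, intervalIntegral.integral_zero, add_zero, zero_mul,
    zero_add]

theorem reachProbFrom_self (hS : S.IsCylindricalFor J T) (hπ : π.IsTimed T) (h : π.clock ≤ T) :
    S.reachProbFrom T π T = M.visited π := by
  rw [hS.reachProbFrom_eq_duhamel hπ ⟨h, le_rfl⟩]
  simp [duhamel]

theorem hasDerivAt_reachProbFrom (hS : S.IsCylindricalFor J T) (hπ : π.IsTimed T)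
    (ht : t ∈ Set.Ioo π.clock T \ (J : Set ℝ)) :
    HasDerivAt (S.reachProbFrom T π) (-S.generator (S.reachProbFrom T) π t) t := by
  have hderiv := (hS.isPiecewiseContinuous_exitRate hπ).hasDerivAt_duhamel
    (hS.isPiecewiseContinuous_jump_reachProbFrom hπ) (M.visited π) ht
  rw [← hS.reachProbFrom_eq_duhamel hπ (Set.Ioo_subset_Icc_self ht.1)] at hderiv
  refine (hderiv.congr_of_eventuallyEq ?_).congr_deriv ?_
  · filter_upwards [isOpen_Ioo.mem_nhds ht.1] with s hs
    exact hS.reachProbFrom_eq_duhamel hπ (Set.Ioo_subset_Icc_self hs)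
  · rw [generator_eq_jump_sub, neg_sub]

theorem isSubsolution_reachProbFrom (hS : S.IsCylindricalFor J T) :
    S.IsSubsolution J T (S.reachProbFrom T) :=
  ⟨hS.isRegular_reachProbFrom, fun _ hπ _ ht => ⟨_, hS.hasDerivAt_reachProbFrom hπ ht, le_rfl⟩⟩

theorem isSupersolution_reachProbFrom (hS : S.IsCylindricalFor J T) :
    S.IsSupersolution J T (S.reachProbFrom T) :=
  ⟨hS.isRegular_reachProbFrom, fun _ hπ _ ht => ⟨_, hS.hasDerivAt_reachProbFrom hπ ht, le_rfl⟩⟩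

theorem reachProbFrom_le_one (hS : S.IsCylindricalFor J T) (hπ : π.IsTimed T)
    (ht : t ∈ Set.Icc π.clock T) : S.reachProbFrom T π t ≤ 1 :=
  hS.isSubsolution_reachProbFrom.le_of_isSupersolution (S.isSupersolution_const J T 1)
    (fun π hπ h => (hS.reachProbFrom_self hπ h).trans_le (M.visited_le_one π)) hπ ht

theorem reachProbFrom_le_exp_mul (hS : S.IsCylindricalFor J T) (hπ : π.IsTimed T) {t' : ℝ}
    (ht : t ∈ Set.Icc π.clock T) (ht' : t' ∈ Set.Icc t T) :
    S.reachProbFrom T π t' ≤ Real.exp (M.totalRate * (t' - t)) * S.reachProbFrom T π t := by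
  have hgen (s : ℝ) : -S.generator (S.reachProbFrom T) π s ≤
      M.totalRate * S.reachProbFrom T π s := by
    have hjump : 0 ≤ S.jump (S.reachProbFrom T) π s :=
      jump_nonneg fun _ _ => S.reachProbFrom_nonneg T _ _
    have hexit := mul_le_mul_of_nonneg_right (NNReal.coe_le_coe.2 (S.exitRate_le π s))
      (S.reachProbFrom_nonneg T π s)
    rw [generator_eq_jump_sub]
    linarith
  have hmono := le_of_hasDerivAt_nonneg_off_finset J ht'.1
    (g := fun s => -(Real.exp (-M.totalRate * s) * S.reachProbFrom T π s)) ?_ fun s hs => ?_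
  · have hexp (s : ℝ) : Real.exp (M.totalRate * (t' - s)) =
        Real.exp (M.totalRate * t') * Real.exp (-M.totalRate * s) := by
      rw [← Real.exp_add]; ring_nf
    have hone := hexp t'
    rw [sub_self, mul_zero, Real.exp_zero] at hone
    rw [hexp]
    linear_combination mul_le_mul_of_nonneg_left (neg_le_neg_iff.1 hmono)
      (Real.exp_pos (M.totalRate * t')).le + S.reachProbFrom T π t' * hone
  · exact ((by fun_prop : Continuous fun s : ℝ => Real.exp (-M.totalRate * s)).continuousOn.mul
      ((hS.isRegular_reachProbFrom.continuousOn π hπ).mono (Set.Icc_subset_Icc ht.1 ht'.2))).neg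
  · have hs' : s ∈ Set.Ioo π.clock T \ (J : Set ℝ) :=
      ⟨⟨ht.1.trans_lt hs.1.1, hs.1.2.trans_le ht'.2⟩, hs.2⟩
    refine ⟨_, (hasDerivAt_exp_neg_mul M.totalRate (hS.hasDerivAt_reachProbFrom hπ hs')).neg, ?_⟩
    rw [← mul_neg]
    exact mul_nonneg (Real.exp_pos _).le (by linarith [hgen s])

end IsCylindricalFor

end Scheduler

/-! ### Solutions of the optimality equations as bounds -/

section OptimalityEquation

variable {S : M.Scheduler} {J : Finset ℝ} {T : ℝ} {f : L → ℝ → ℝ} {π : TimedPath L Act} {t : ℝ}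

open Classical in
/-- The extension of `f` to histories: the value of a history is `1` once the goal region has been
visited, also if a transition with rate `0` has left it again, and `f π.last` before. -/
noncomputable def valueFrom (M : CTMDP L Act) (f : L → ℝ → ℝ) (π : TimedPath L Act) (t : ℝ) : ℝ :=
  if π.Visits M.goal then 1 else f π.last t

theorem valueFrom_of_visits (f : L → ℝ → ℝ) (h : π.Visits M.goal) : M.valueFrom f π = 1 :=
  funext fun _ => if_pos h

theorem valueFrom_of_not_visits (f : L → ℝ → ℝ) (h : ¬π.Visits M.goal) :
    M.valueFrom f π = f π.last :=
  funext fun _ => if_neg h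

theorem BoundaryConditions.valueFrom_start (hf : M.BoundaryConditions T f) (l : L)
    (ht : t ∈ Set.Icc 0 T) : M.valueFrom f (.start l) t = f l t := by
  by_cases h : l ∈ M.goal
  · rw [valueFrom_of_visits f (π := .start l) h, hf.1 l h t ht, Pi.one_apply]
  · rw [valueFrom_of_not_visits f (π := .start l) h, TimedPath.last]

theorem BoundaryConditions.valueFrom_step (hf : M.BoundaryConditions T f)
    (h : ¬π.Visits M.goal) (a : Act) (s : ℝ) (l : L) (ht : t ∈ Set.Icc 0 T) :
    M.valueFrom f (π.step a s l) t = f l t := by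
  by_cases hl : l ∈ M.goal
  · rw [valueFrom_of_visits f (π := π.step a s l) (.inr hl), hf.1 l hl t ht, Pi.one_apply]
  · rw [valueFrom_of_not_visits f (π := π.step a s l) (not_or_intro h hl), TimedPath.last]

theorem BoundaryConditions.valueFrom_self (hf : M.BoundaryConditions T f) (π : TimedPath L Act) :
    M.valueFrom f π T = M.visited π := by
  by_cases h : π.Visits M.goal
  · rw [valueFrom_of_visits f h, visited_of_visits h, Pi.one_apply]
  · rw [valueFrom_of_not_visits f h, visited_of_not_visits h,
      hf.2 _ (mt TimedPath.visits_of_last_mem h)]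

theorem isRegular_valueFrom (M : CTMDP L Act) (hf : ∀ l, ContinuousOn (f l) (Set.Icc 0 T)) :
    TimedPath.IsRegular T (M.valueFrom f) where
  continuousOn π hπ := by
    by_cases h : π.Visits M.goal
    · rw [valueFrom_of_visits f h]
      exact continuousOn_const
    · rw [valueFrom_of_not_visits f h]
      exact (hf π.last).mono (Set.Icc_subset_Icc_left hπ.clock_nonneg)
  bounded := by
    choose K hK using fun l => isCompact_Icc.exists_bound_of_continuousOn (hf l)
    have hbound (π : TimedPath L Act) (hπ : π.IsTimed T) (t : ℝ) (ht : t ∈ Set.Icc π.clock T) :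
        |f π.last t| ≤ ∑ l, |K l| :=
      (hK _ t ⟨hπ.clock_nonneg.trans ht.1, ht.2⟩).trans ((le_abs_self _).trans
        (Finset.single_le_sum (f := fun l => |K l|) (fun _ _ => abs_nonneg _) (Finset.mem_univ _)))
    refine ⟨max 1 (∑ l, |K l|), fun π hπ t ht => ?_⟩
    by_cases h : π.Visits M.goal
    · simp [valueFrom_of_visits f h]
    · rw [valueFrom_of_not_visits f h]
      exact (hbound π hπ t ht).trans (le_max_right _ _)

namespace Scheduler

theorem sum_prob_mul_le {x : Act → ℝ} {c : ℝ} (h : ∀ a ∈ M.enabled π.last, x a ≤ c) :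
    ∑ a, (S.prob π t a : ℝ) * x a ≤ c :=
  calc ∑ a, (S.prob π t a : ℝ) * x a ≤ ∑ a, (S.prob π t a : ℝ) * c := by
        refine Finset.sum_le_sum fun a _ => ?_
        by_cases ha : S.prob π t a = 0
        · simp only [ha, NNReal.coe_zero, zero_mul, le_refl]
        · exact mul_le_mul_of_nonneg_left (h a (S.enabled_of_ne_zero π t a ha))
            (NNReal.coe_nonneg _)
    _ = c := by rw [← Finset.sum_mul, ← NNReal.coe_sum, S.sum_eq_one, NNReal.coe_one, one_mul]

theorem le_sum_prob_mul {x : Act → ℝ} {c : ℝ} (h : ∀ a ∈ M.enabled π.last, c ≤ x a) :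
    c ≤ ∑ a, (S.prob π t a : ℝ) * x a := by
  have hneg := S.sum_prob_mul_le (t := t) (x := -x) (c := -c) fun a ha => neg_le_neg (h a ha)
  simpa only [Pi.neg_apply, mul_neg, Finset.sum_neg_distrib, neg_le_neg_iff] using hneg

theorem generator_valueFrom_of_visits (S : M.Scheduler) (f : L → ℝ → ℝ) (t : ℝ)
    (h : π.Visits M.goal) : S.generator (M.valueFrom f) π t = 0 := by
  have hstep (a : Act) (l : L) : M.valueFrom f (π.step a t l) t = 1 := by
    rw [valueFrom_of_visits f (π := π.step a t l) (.inl h), Pi.one_apply]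
  simp only [generator, hstep, valueFrom_of_visits f h, Pi.one_apply, sub_self, rateSum_const,
    mul_zero]

theorem generator_valueFrom_of_not_visits (S : M.Scheduler) (hf : M.BoundaryConditions T f)
    (ht : t ∈ Set.Icc 0 T) (h : ¬π.Visits M.goal) : S.generator (M.valueFrom f) π t =
      ∑ a, (S.prob π t a : ℝ) * M.drift (fun l => f l t) π.last a := by
  simp only [generator, rateSum, drift, hf.valueFrom_step h _ _ _ ht, valueFrom_of_not_visits f h,
    Finset.mul_sum, mul_assoc]

theorem isSupersolution_valueFrom (S : M.Scheduler) (J : Finset ℝ)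
    (hf : M.BoundaryConditions T f) (hderiv : ∀ l, ∀ t ∈ Set.Icc 0 T, ∃ f',
      HasDerivWithinAt (f l) f' (Set.Icc 0 T) t ∧
        ∀ a ∈ M.enabled l, M.drift (fun l' => f l' t) l a ≤ -f') :
    S.IsSupersolution J T (M.valueFrom f) where
  toIsRegular := M.isRegular_valueFrom fun l t ht =>
    let ⟨_, hf', _⟩ := hderiv l t ht
    hf'.continuousWithinAt
  hasDerivAt π hπ t ht := by
    have htT : t ∈ Set.Ioo 0 T := ⟨hπ.clock_nonneg.trans_lt ht.1.1, ht.1.2⟩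
    by_cases h : π.Visits M.goal
    · refine ⟨0, valueFrom_of_visits f h ▸ hasDerivAt_const t 1, ?_⟩
      rw [S.generator_valueFrom_of_visits f t h, neg_zero]
    · obtain ⟨f', hf', hle⟩ := hderiv π.last t (Set.Ioo_subset_Icc_self htT)
      refine ⟨f', valueFrom_of_not_visits f h ▸ hf'.hasDerivAt (Icc_mem_nhds htT.1 htT.2), ?_⟩
      rw [S.generator_valueFrom_of_not_visits hf (Set.Ioo_subset_Icc_self htT) h]
      exact le_neg_of_le_neg (sum_prob_mul_le hle)

theorem isSubsolution_valueFrom (S : M.Scheduler) (J : Finset ℝ)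
    (hf : M.BoundaryConditions T f) (hderiv : ∀ l, ∀ t ∈ Set.Icc 0 T, ∃ f',
      HasDerivWithinAt (f l) f' (Set.Icc 0 T) t ∧
        ∀ a ∈ M.enabled l, -f' ≤ M.drift (fun l' => f l' t) l a) :
    S.IsSubsolution J T (M.valueFrom f) where
  toIsRegular := M.isRegular_valueFrom fun l t ht =>
    let ⟨_, hf', _⟩ := hderiv l t ht
    hf'.continuousWithinAt
  hasDerivAt π hπ t ht := by
    have htT : t ∈ Set.Ioo 0 T := ⟨hπ.clock_nonneg.trans_lt ht.1.1, ht.1.2⟩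
    by_cases h : π.Visits M.goal
    · refine ⟨0, valueFrom_of_visits f h ▸ hasDerivAt_const t 1, ?_⟩
      rw [S.generator_valueFrom_of_visits f t h, neg_zero]
    · obtain ⟨f', hf', hle⟩ := hderiv π.last t (Set.Ioo_subset_Icc_self htT)
      refine ⟨f', valueFrom_of_not_visits f h ▸ hf'.hasDerivAt (Icc_mem_nhds htT.1 htT.2), ?_⟩
      rw [S.generator_valueFrom_of_not_visits hf (Set.Ioo_subset_Icc_self htT) h]
      exact neg_le_of_neg_le (le_sum_prob_mul hle)

theorem IsCylindrical.reachProb_le_of_isFMax (hS : S.IsCylindrical T) (hf : M.IsFMax T f) (l : L)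
    (ht : t ∈ Set.Icc 0 T) : S.reachProb T l t ≤ f l t := by
  obtain ⟨J, hJ⟩ := hS.exists_isCylindricalFor
  have hvalue : S.IsSupersolution J T (M.valueFrom f) :=
    S.isSupersolution_valueFrom J hf.1 fun l t ht =>
      ⟨_, hf.2 l t ht, fun a ha => by rw [neg_neg]; exact Finset.le_sup' _ ha⟩
  rw [reachProb, ← hf.1.valueFrom_start l ht]
  exact hJ.isSubsolution_reachProbFrom.le_of_isSupersolution hvalue
    (fun π hπ h => by rw [hJ.reachProbFrom_self hπ h, hf.1.valueFrom_self])
    (π := .start l) trivial ht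

theorem IsCylindrical.le_reachProb_of_isFMin (hS : S.IsCylindrical T) (hf : M.IsFMin T f) (l : L)
    (ht : t ∈ Set.Icc 0 T) : f l t ≤ S.reachProb T l t := by
  obtain ⟨J, hJ⟩ := hS.exists_isCylindricalFor
  have hvalue : S.IsSubsolution J T (M.valueFrom f) :=
    S.isSubsolution_valueFrom J hf.1 fun l t ht =>
      ⟨_, hf.2 l t ht, fun a ha => by rw [neg_neg]; exact Finset.inf'_le _ ha⟩
  rw [reachProb, ← hf.1.valueFrom_start l ht]
  exact hvalue.le_of_isSupersolution hJ.isSupersolution_reachProbFrom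
    (fun π hπ h => by rw [hJ.reachProbFrom_self hπ h, hf.1.valueFrom_self])
    (π := .start l) trivial ht

end Scheduler

end OptimalityEquation
end CTMDP

/-! ### The difference process -/

namespace CTMDP

section OldPath

variable {L Act : Type*} {J : Finset ℝ} {T : ℝ} {π π' : TimedPath (Option L) (DiffAct Act)}
  {ρ : TimedPath L Act}

theorem oldPath_step_some (h : oldPath π = some ρ) (a : Act) (t : ℝ) (l : L) :
    oldPath (π.step (some (.inl a)) t (some l)) = some (ρ.step a t l) := by
  rw [oldPath, h, Option.map_some]

theorem oldPath_step_none (h : oldPath π = none) (x : DiffAct Act) (t : ℝ) (l : Option L) :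
    oldPath (π.step x t l) = none := by
  rcases x with _ | a | a <;> rcases l with _ | l <;> simp [oldPath, h]

theorem clock_of_oldPath (h : oldPath π = some ρ) : ρ.clock = π.clock := by
  rcases π with (_ | l) | ⟨π, (_ | a | a), t, (_ | l)⟩ <;>
    simp only [oldPath, Option.map_eq_some_iff, Option.some.injEq, reduceCtorEq] at h
  · subst h; rfl
  · obtain ⟨σ, _, rfl⟩ := h; rfl

theorem isTimed_of_oldPath (h : oldPath π = some ρ) (hπ : π.IsTimed T) : ρ.IsTimed T := by
  induction π generalizing ρ with
  | start l =>
    rcases l with _ | l <;> simp only [oldPath, Option.some.injEq, reduceCtorEq] at h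
    subst h
    trivial
  | step π x t l ih =>
    rcases x with _ | a | a <;> rcases l with _ | l <;>
      simp only [oldPath, Option.map_eq_some_iff, reduceCtorEq] at h
    obtain ⟨σ, hσ, rfl⟩ := h
    exact ⟨ih hσ hπ.1, (clock_of_oldPath hσ).trans_le hπ.2.1, hπ.2.2⟩

theorem rel_oldPath (h : TimedPath.SameCylinder J π π') :
    Option.Rel (TimedPath.SameCylinder J) (oldPath π) (oldPath π') := by
  induction π generalizing π' with
  | start l =>
    rcases π' with l' | _
    · obtain rfl : l = l' := h
      rcases l with _ | l
      exacts [.none, .some (.refl _)]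
    · exact h.elim
  | step π x t l ih =>
    rcases π' with _ | ⟨π', x', t', l'⟩
    · exact h.elim
    · obtain ⟨hπ, rfl, ht, rfl⟩ := h
      rcases x with _ | a | a <;> rcases l with _ | l <;> try exact .none
      simp only [oldPath]
      exact match oldPath π, oldPath π', ih hπ with
        | _, _, .none => .none
        | some ρ, some ρ', .some hρ => .some <|
          show TimedPath.SameCylinder J (ρ.step a t l) (ρ'.step a t' l) from ⟨hρ, rfl, ht, rfl⟩

end OldPath

variable {L Act : Type*} [Fintype L] [Fintype Act] {M : CTMDP L Act}

theorem exitRate_le_of_surplusAction {l : L} {p q : Act → ℝ≥0} {a : Act}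
    (h : M.surplusAction l p q = some a) {b : Act} (hb : q b < p b) :
    M.exitRate l b ≤ M.exitRate l a := by
  classical
  unfold surplusAction at h
  split_ifs at h with hn
  have hmax := (Finset.exists_max_image _ (M.exitRate l) hn).choose_spec.2 b
    (Finset.mem_filter.2 ⟨Finset.mem_univ b, hb⟩)
  rwa [Option.some.inj h] at hmax

theorem diffDecision_swap (M : CTMDP L Act) (l : L) (p q : Act → ℝ≥0) (a b : Act) :
    M.diffDecision l p q (some (.inr (a, b))) = M.diffDecision l q p (some (.inr (b, a))) := by
  classical
  simp only [diffDecision, min_comm (q _)]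
  exact if_congr and_comm rfl rfl

/-- The total rate at which the difference process enters the fresh goal location from `l`, if the
two schedulers choose the distributions `p` and `q`. -/
noncomputable def freshRate (M : CTMDP L Act) (l : L) (p q : Act → ℝ≥0) : ℝ≥0 :=
  ∑ x : Act × Act, M.diffDecision l p q (some (.inr x)) * (M.exitRate l x.1 + M.exitRate l x.2)

theorem freshRate_comm (M : CTMDP L Act) (l : L) (p q : Act → ℝ≥0) :
    M.freshRate l p q = M.freshRate l q p :=
  Fintype.sum_equiv (Equiv.prodComm Act Act) _ _ fun x => by
    rw [diffDecision_swap, add_comm]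
    rfl

theorem freshRate_eq_mul {l : L} {p q : Act → ℝ≥0} {a b : Act}
    (ha : M.surplusAction l p q = some a) (hb : M.surplusAction l q p = some b) :
    M.freshRate l p q = (1 - ∑ c, min (p c) (q c)) * (M.exitRate l a + M.exitRate l b) := by
  rw [freshRate, Finset.sum_eq_single (a, b)]
  · simp only [diffDecision, ha, hb, and_self, if_true]
  · rintro ⟨x, y⟩ _ hxy
    have hne : ¬(a = x ∧ b = y) := fun h => hxy (Prod.ext h.1.symm h.2.symm)
    have hzero : M.diffDecision l p q (some (.inr (x, y))) = 0 :=
      if_neg (by simpa only [ha, hb, Option.some.injEq] using hne)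
    rw [hzero, zero_mul]
  · exact fun h => absurd (Finset.mem_univ _) h

theorem sum_mul_exitRate_le_add_freshRate {l : L} {p q : Act → ℝ≥0} (hp : ∑ a, p a = 1)
    (hq : ∑ a, q a = 1) : ∑ a, p a * M.exitRate l a ≤
      ∑ a, min (p a) (q a) * M.exitRate l a + M.freshRate l p q := by
  rcases ha : M.surplusAction l p q with _ | a
  · simp [eq_of_surplusAction_eq_none hp hq ha]
  rcases hb : M.surplusAction l q p with _ | b
  · simp [eq_of_surplusAction_eq_none hq hp hb]
  have hmin (c : Act) : min (p c) (q c) + (p c - min (p c) (q c)) = p c :=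
    add_tsub_cancel_of_le (min_le_left _ _)
  have hmass : ∑ c, (p c - min (p c) (q c)) = 1 - ∑ c, min (p c) (q c) :=
    eq_tsub_of_add_eq (by rw [add_comm, ← Finset.sum_add_distrib, Fintype.sum_congr _ _ hmin, hp])
  have hexit (c : Act) : (p c - min (p c) (q c)) * M.exitRate l c ≤
      (p c - min (p c) (q c)) * M.exitRate l a := by
    rcases lt_or_ge (q c) (p c) with hc | hc
    · exact mul_le_mul_right (exitRate_le_of_surplusAction ha hc) _
    · simp only [min_eq_left hc, tsub_self, zero_mul, le_refl]
  calc ∑ c, p c * M.exitRate l c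
      = ∑ c, min (p c) (q c) * M.exitRate l c +
          ∑ c, (p c - min (p c) (q c)) * M.exitRate l c := by
        simp only [← Finset.sum_add_distrib, ← add_mul, hmin]
    _ ≤ ∑ c, min (p c) (q c) * M.exitRate l c +
          ∑ c, (p c - min (p c) (q c)) * M.exitRate l a :=
        add_le_add_right (Finset.sum_le_sum fun c _ => hexit c) _
    _ ≤ ∑ c, min (p c) (q c) * M.exitRate l c + M.freshRate l p q := by
        rw [← Finset.sum_mul, hmass, freshRate_eq_mul ha hb]
        gcongr
        exact le_self_add

theorem rateSum_le_add_mul {l : L} {p m : Act → ℝ≥0} (hmp : ∀ a, m a ≤ p a) {F : ℝ≥0}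
    (hF : ∑ a, p a * M.exitRate l a ≤ ∑ a, m a * M.exitRate l a + F) {x : Act → L → ℝ} {c : ℝ}
    (hc : 0 ≤ c) (hx : ∀ a l', x a l' ≤ c) :
    M.rateSum l p x ≤ M.rateSum l m x + F * c := by
  have hle : M.rateSum l m (fun a l' => c - x a l') ≤ M.rateSum l p fun a l' => c - x a l' := by
    unfold rateSum
    gcongr with a _ l' _
    · exact sub_nonneg.2 (hx a l')
    · exact hmp a
  rw [rateSum_sub, rateSum_sub, rateSum_const, rateSum_const] at hle
  have hFc := mul_le_mul_of_nonneg_right (NNReal.coe_le_coe.2 hF) hc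
  rw [NNReal.coe_add, add_mul] at hFc
  linarith

theorem sub_mul_le_rateSum {l : L} {p m : Act → ℝ≥0} (hmp : ∀ a, m a ≤ p a) {F : ℝ≥0}
    (hF : ∑ a, p a * M.exitRate l a ≤ ∑ a, m a * M.exitRate l a + F) {x : Act → L → ℝ} {c : ℝ}
    (hc : 0 ≤ c) (hx : ∀ a l', -c ≤ x a l') :
    M.rateSum l m x - F * c ≤ M.rateSum l p x := by
  have hneg := rateSum_le_add_mul hmp hF hc fun a l' => neg_le.1 (hx a l')
  rw [rateSum_neg, rateSum_neg] at hneg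
  linarith

theorem rateSum_diffDecision (M : CTMDP L Act) (l : L) (p q : Act → ℝ≥0)
    {x : DiffAct Act → Option L → ℝ} {c : ℝ} (hx : ∀ y, x (some (.inr y)) none = c) :
    M.diff.rateSum (some l) (M.diffDecision l p q) x =
      M.rateSum l (fun a => min (p a) (q a)) (fun a l' => x (some (.inl a)) (some l')) +
        M.freshRate l p q * c := by
  have hnone : M.diffDecision l p q none = 0 := rfl
  have hinl (a : Act) : M.diffDecision l p q (some (.inl a)) = min (p a) (q a) := rfl
  simp [rateSum, freshRate, diff, diffRate, Fintype.sum_option, hnone, hinl, hx, Finset.sum_mul]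

/-- The difference of the reachability probabilities of `D` and `E` as a function of the histories
of the difference process: where the underlying old path does not exist, it is replaced by the
indicator of the fresh goal location. -/
noncomputable def Scheduler.reachGap (D E : M.Scheduler) (T : ℝ)
    (π : TimedPath (Option L) (DiffAct Act)) (t : ℝ) : ℝ :=
  (oldPath π).elim (M.diff.visited π) fun ρ => D.reachProbFrom T ρ t - E.reachProbFrom T ρ t

namespace Scheduler

variable {D E : M.Scheduler} {J : Finset ℝ} {T t : ℝ} {π : TimedPath (Option L) (DiffAct Act)}
  {ρ : TimedPath L Act}

theorem reachGap_of_some (h : oldPath π = some ρ) :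
    D.reachGap E T π = fun t => D.reachProbFrom T ρ t - E.reachProbFrom T ρ t := by
  funext t
  rw [reachGap, h, Option.elim_some]

theorem reachGap_of_none (h : oldPath π = none) :
    D.reachGap E T π = fun _ => M.diff.visited π := by
  funext t
  rw [reachGap, h, Option.elim_none]

theorem reachGap_step_fresh (D E : M.Scheduler) (T : ℝ) (π : TimedPath (Option L) (DiffAct Act))
    (x : Act × Act) (s t : ℝ) : D.reachGap E T (π.step (some (.inr x)) s none) t = 1 :=
  visited_of_visits (Or.inr rfl)

theorem prob_diff_of_some (h : oldPath π = some ρ) (t : ℝ) :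
    (D.diff E).prob π t = M.diffDecision ρ.last (D.prob ρ t) (E.prob ρ t) := by
  funext x
  simp only [Scheduler.diff, h]

theorem IsCylindricalFor.diff (hD : D.IsCylindricalFor J T) (hE : E.IsCylindricalFor J T) :
    (D.diff E).IsCylindricalFor J T := by
  intro π π' t ht t' ht' hπ hπ' h hcell
  have hrel := rel_oldPath h
  rcases hρ : oldPath π with _ | ρ <;> rcases hρ' : oldPath π' with _ | ρ' <;>
    rw [hρ, hρ'] at hrel <;> rcases hrel with hrel | _
  · have hchoose {l l' : Option L} (hl : l = l') :
        (M.diff.exists_enabled l).choose = (M.diff.exists_enabled l').choose := by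
      subst hl; rfl
    funext x
    simp only [Scheduler.diff, hρ, hρ']
    rw [hchoose h.last_eq]
  · have hρt := isTimed_of_oldPath hρ hπ
    have hρt' := isTimed_of_oldPath hρ' hπ'
    rw [prob_diff_of_some hρ, prob_diff_of_some hρ', hrel.last_eq,
      hD ρ ρ' t ht t' ht' hρt hρt' hrel hcell, hE ρ ρ' t ht t' ht' hρt hρt' hrel hcell]

theorem IsCylindricalFor.isRegular_reachGap (hD : D.IsCylindricalFor J T)
    (hE : E.IsCylindricalFor J T) : TimedPath.IsRegular T (D.reachGap E T) where
  continuousOn π hπ := by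
    rcases h : oldPath π with _ | ρ
    · rw [reachGap_of_none h]
      exact continuousOn_const
    · rw [reachGap_of_some h, ← clock_of_oldPath h]
      exact (hD.isRegular_reachProbFrom.sub hE.isRegular_reachProbFrom).continuousOn ρ
        (isTimed_of_oldPath h hπ)
  bounded := by
    obtain ⟨K, hK⟩ := (hD.isRegular_reachProbFrom.sub hE.isRegular_reachProbFrom).bounded
    refine ⟨max K 1, fun π hπ t ht => ?_⟩
    rcases h : oldPath π with _ | ρ
    · rw [reachGap_of_none h, abs_of_nonneg (visited_nonneg _ _)]
      exact (visited_le_one _ _).trans (le_max_right _ _)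
    · rw [reachGap_of_some h]
      rw [← clock_of_oldPath h] at ht
      exact (hK ρ (isTimed_of_oldPath h hπ) t ht).trans (le_max_left _ _)

theorem generator_reachGap_nonneg_of_none (h : oldPath π = none) :
    0 ≤ (D.diff E).generator (D.reachGap E T) π t := by
  refine rateSum_nonneg fun x k => sub_nonneg.2 ?_
  rw [reachGap_of_none h, reachGap_of_none (oldPath_step_none h x t k)]
  exact M.diff.visited_le_visited_step π x t k

/-- Where only one of the schedulers takes a transition, the difference process enters the fresh
goal location, whose gap `1` is at least the one that this transition can create. -/
theorem IsCylindricalFor.generator_sub_generator_le_of_some (hD : D.IsCylindricalFor J T)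
    (h : oldPath π = some ρ) (hπ : π.IsTimed T) (ht : t ∈ Set.Icc π.clock T) :
    D.generator (D.reachProbFrom T) ρ t - E.generator (E.reachProbFrom T) ρ t ≤
      (D.diff E).generator (D.reachGap E T) π t := by
  have hρ := isTimed_of_oldPath h hπ
  rw [← clock_of_oldPath h] at ht
  have hDone : 0 ≤ 1 - D.reachProbFrom T ρ t := sub_nonneg.2 (hD.reachProbFrom_le_one hρ ht)
  have hstep (a : Act) (l' : L) : D.reachProbFrom T (ρ.step a t l') t ≤ 1 :=
    hD.reachProbFrom_le_one (π := ρ.step a t l') ⟨hρ, ht⟩ ⟨le_rfl, ht.2⟩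
  have hDgen := rateSum_le_add_mul (fun a => min_le_left (D.prob ρ t a) (E.prob ρ t a))
    (sum_mul_exitRate_le_add_freshRate (M := M) (l := ρ.last) (D.sum_eq_one ρ t) (E.sum_eq_one ρ t))
    hDone fun a l' => sub_le_sub_right (hstep a l') _
  have hEgen := sub_mul_le_rateSum (fun a => min_le_left (E.prob ρ t a) (D.prob ρ t a))
    (sum_mul_exitRate_le_add_freshRate (M := M) (l := ρ.last) (E.sum_eq_one ρ t) (D.sum_eq_one ρ t))
    (E.reachProbFrom_nonneg T ρ t) (x := fun a l' => E.reachProbFrom T (ρ.step a t l') t -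
      E.reachProbFrom T ρ t) fun a l' => by linarith [E.reachProbFrom_nonneg T (ρ.step a t l') t]
  simp only [freshRate_comm _ _ (E.prob ρ t), min_comm (E.prob ρ t _)] at hEgen
  rw [generator, generator, generator, last_of_oldPath h, prob_diff_of_some h,
    M.rateSum_diffDecision _ _ _ fun y => by rw [reachGap_step_fresh]]
  simp only [reachGap_of_some h, reachGap_of_some (oldPath_step_some h _ _ _), sub_sub_sub_comm,
    rateSum_sub _ _ _ (fun a l' => D.reachProbFrom T (ρ.step a t l') t - _)]
  linarith

theorem IsCylindricalFor.isSubsolution_reachGap (hD : D.IsCylindricalFor J T)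
    (hE : E.IsCylindricalFor J T) : (D.diff E).IsSubsolution J T (D.reachGap E T) where
  toIsRegular := hD.isRegular_reachGap hE
  hasDerivAt π hπ t ht := by
    rcases h : oldPath π with _ | ρ
    · rw [reachGap_of_none h]
      exact ⟨0, hasDerivAt_const _ _, neg_nonpos.2 (generator_reachGap_nonneg_of_none h)⟩
    · have hρ := isTimed_of_oldPath h hπ
      have hle := hD.generator_sub_generator_le_of_some (E := E) h hπ
        (Set.Ioo_subset_Icc_self ht.1)
      rw [← clock_of_oldPath h] at ht
      rw [reachGap_of_some h]
      exact ⟨_, (hD.hasDerivAt_reachProbFrom hρ ht).sub (hE.hasDerivAt_reachProbFrom hρ ht), by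
        linarith⟩

theorem IsCylindricalFor.reachGap_self_le_visited (hD : D.IsCylindricalFor J T)
    (hE : E.IsCylindricalFor J T) (hπ : π.IsTimed T) (hclock : π.clock ≤ T) :
    D.reachGap E T π T ≤ M.diff.visited π := by
  rcases h : oldPath π with _ | ρ
  · rw [reachGap_of_none h]
  · have hρ := isTimed_of_oldPath h hπ
    rw [← clock_of_oldPath h] at hclock
    simp only [reachGap_of_some h, hD.reachProbFrom_self hρ hclock,
      hE.reachProbFrom_self hρ hclock, sub_self]
    exact M.diff.visited_nonneg π

theorem IsCylindricalFor.reachGap_le (hD : D.IsCylindricalFor J T) (hE : E.IsCylindricalFor J T)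
    (hπ : π.IsTimed T) (ht : t ∈ Set.Icc π.clock T) :
    D.reachGap E T π t ≤ (D.diff E).reachProbFrom T π t :=
  (hD.isSubsolution_reachGap hE).le_of_isSupersolution (hD.diff hE).isSupersolution_reachProbFrom
    (fun _ hπ hclock => (hD.reachGap_self_le_visited hE hπ hclock).trans_eq
      ((hD.diff hE).reachProbFrom_self hπ hclock).symm) hπ ht

end Scheduler

/-! ### Reachability probabilities and the distance -/

namespace Scheduler

variable {D E : M.Scheduler} {T t : ℝ}

theorem IsCylindrical.exists_isCylindricalFor₂ (hD : D.IsCylindrical T) (hE : E.IsCylindrical T) :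
    ∃ J, D.IsCylindricalFor J T ∧ E.IsCylindricalFor J T := by
  classical
  obtain ⟨J, hJ⟩ := hD.exists_isCylindricalFor
  obtain ⟨J', hJ'⟩ := hE.exists_isCylindricalFor
  exact ⟨J ∪ J', hJ.mono Finset.subset_union_left, hJ'.mono Finset.subset_union_right⟩

theorem IsCylindrical.reachProb_sub_le (hD : D.IsCylindrical T) (hE : E.IsCylindrical T) (l : L)
    (ht : t ∈ Set.Icc 0 T) :
    D.reachProb T l t - E.reachProb T l t ≤ (D.diff E).reachProb T (some l) t := by
  obtain ⟨J, hDJ, hEJ⟩ := hD.exists_isCylindricalFor₂ hE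
  exact hDJ.reachGap_le hEJ (π := .start (some l)) trivial ht

theorem distance_eq_sum (T : ℝ) (D E : M.Scheduler) :
    distance T D E = ∑ l, (M.init l : ℝ) * (D.diff E).reachProb T (some l) 0 := by
  simp [distance, totalReachProb, CTMDP.diff, Fintype.sum_option]

theorem distance_nonneg (T : ℝ) (D E : M.Scheduler) : 0 ≤ distance T D E :=
  Finset.sum_nonneg fun _ _ => mul_nonneg (NNReal.coe_nonneg _)
    ((D.diff E).reachProbFrom_nonneg T _ _)

theorem init_mul_reachProb_diff_le_distance (T : ℝ) (D E : M.Scheduler) (l : L) :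
    M.init l * (D.diff E).reachProb T (some l) 0 ≤ distance T D E := by
  rw [distance_eq_sum]
  exact Finset.single_le_sum (f := fun l => (M.init l : ℝ) * (D.diff E).reachProb T (some l) 0)
    (fun l _ => mul_nonneg (M.init l).coe_nonneg ((D.diff E).reachProbFrom_nonneg _ _ _))
    (Finset.mem_univ l)

theorem IsCylindrical.reachProb_sub_le_mul_distance (hD : D.IsCylindrical T)
    (hE : E.IsCylindrical T) {l : L} (hl : 0 < M.init l) (ht : t ∈ Set.Icc 0 T) :
    D.reachProb T l t - E.reachProb T l t ≤
      Real.exp (M.diff.totalRate * t) / M.init l * distance T D E := by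
  obtain ⟨J, hDJ, hEJ⟩ := hD.exists_isCylindricalFor₂ hE
  have hl' : (0 : ℝ) < M.init l := NNReal.coe_pos.2 hl
  have hinit : (D.diff E).reachProb T (some l) 0 ≤ distance T D E / M.init l :=
    (le_div_iff₀' hl').2 (init_mul_reachProb_diff_le_distance T D E l)
  calc D.reachProb T l t - E.reachProb T l t
      ≤ (D.diff E).reachProb T (some l) t := hD.reachProb_sub_le hE l ht
    _ ≤ Real.exp (M.diff.totalRate * (t - 0)) * (D.diff E).reachProb T (some l) 0 :=
        (hDJ.diff hEJ).reachProbFrom_le_exp_mul (π := .start (some l)) trivial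
          ⟨le_rfl, ht.1.trans ht.2⟩ ht
    _ ≤ Real.exp (M.diff.totalRate * (t - 0)) * (distance T D E / M.init l) := by gcongr
    _ = Real.exp (M.diff.totalRate * t) / M.init l * distance T D E := by
        rw [sub_zero, mul_div_left_comm, mul_comm]

theorem IsCylindrical.totalReachProb_sub_le_distance (hT : 0 ≤ T) (hD : D.IsCylindrical T)
    (hE : E.IsCylindrical T) : D.totalReachProb T - E.totalReachProb T ≤ distance T D E := by
  rw [distance_eq_sum, totalReachProb, totalReachProb, ← Finset.sum_sub_distrib]
  simp only [← mul_sub]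
  gcongr with l _
  exact hD.reachProb_sub_le hE l ⟨le_rfl, hT⟩

end Scheduler

theorem MeasurableScheduler.exists_tendsto {T : ℝ} (S : M.MeasurableScheduler T)
    {φ : M.Scheduler → ℝ} {K : ℝ} (hφ : ∀ D E : M.Scheduler, D.IsCylindrical T →
      E.IsCylindrical T → φ D - φ E ≤ K * Scheduler.distance T D E) :
    ∃ p, Tendsto (fun n => φ (S.seq n)) atTop (𝓝 p) := by
  refine cauchySeq_tendsto_of_complete (Metric.cauchySeq_iff.2 fun ε hε => ?_)
  have hK : 0 < |K| + 1 := by positivity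
  obtain ⟨N, hN⟩ := S.cauchy (ε / (|K| + 1)) (div_pos hε hK)
  have hlt : ∀ m > N, ∀ n > N, φ (S.seq m) - φ (S.seq n) < ε := fun m hm n hn =>
    calc φ (S.seq m) - φ (S.seq n)
        ≤ K * Scheduler.distance T (S.seq m) (S.seq n) :=
          hφ _ _ (S.cylindrical m) (S.cylindrical n)
      _ ≤ (|K| + 1) * Scheduler.distance T (S.seq m) (S.seq n) := by
          gcongr
          · exact Scheduler.distance_nonneg _ _ _
          · linarith [le_abs_self K]
      _ < (|K| + 1) * (ε / (|K| + 1)) := mul_lt_mul_of_pos_left (hN m hm n hn) hK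
      _ = ε := mul_div_cancel₀ _ hK.ne'
  refine ⟨N + 1, fun m hm n hn => ?_⟩
  rw [Real.dist_eq, abs_sub_lt_iff]
  exact ⟨hlt m hm n hn, hlt n hn m hm⟩

end CTMDP

theorem lemma1 {L Act : Type*} [Fintype L] [Fintype Act] (M : CTMDP L Act)
    (T : ℝ) (hT : 0 ≤ T) (fmax fmin : L → ℝ → ℝ)
    (hmax : M.IsFMax T fmax) (hmin : M.IsFMin T fmin) (S : M.MeasurableScheduler T) :
    (∀ l, ∀ t ∈ Set.Icc 0 T,
      (0 < M.init l → ∃ p, S.HasReachProb l t p) ∧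
      ∀ p, S.HasReachProb l t p → fmin l t ≤ p ∧ p ≤ fmax l t) ∧
    ∃ p, S.HasTotalReachProb p ∧
      ∑ l, (M.init l : ℝ) * fmin l 0 ≤ p ∧ p ≤ ∑ l, (M.init l : ℝ) * fmax l 0 := by
  have hle (n l) (t) (ht : t ∈ Set.Icc 0 T) : (S.seq n).reachProb T l t ≤ fmax l t :=
    (S.cylindrical n).reachProb_le_of_isFMax hmax l ht
  have hge (n l) (t) (ht : t ∈ Set.Icc 0 T) : fmin l t ≤ (S.seq n).reachProb T l t :=
    (S.cylindrical n).le_reachProb_of_isFMin hmin l ht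
  have h₀ : (0 : ℝ) ∈ Set.Icc 0 T := ⟨le_rfl, hT⟩
  refine ⟨fun l t ht => ⟨fun hl => ?_, fun p hp => ⟨?_, ?_⟩⟩, ?_⟩
  · exact S.exists_tendsto fun D E hD hE => hD.reachProb_sub_le_mul_distance hE hl ht
  · exact ge_of_tendsto' hp fun n => hge n l t ht
  · exact le_of_tendsto' hp fun n => hle n l t ht
  · obtain ⟨p, hp⟩ := S.exists_tendsto (K := 1) fun D E hD hE =>
      (hD.totalReachProb_sub_le_distance hT hE).trans_eq (one_mul _).symm
    refine ⟨p, hp, ge_of_tendsto' hp fun n => ?_, le_of_tendsto' hp fun n => ?_⟩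
    · exact Finset.sum_le_sum fun l _ => mul_le_mul_of_nonneg_left (hge n l 0 h₀) (by positivity)
    · exact Finset.sum_le_sum fun l _ => mul_le_mul_of_nonneg_left (hle n l 0 h₀) (by positivity)
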